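/- Let $d\in\mathbb N$ and let $\mathcal P_2(\mathbb R^d)$ be the set of Borel probability measures on $\mathbb R^d$ with finite second order moment. For $\mu,\eta\in\mathcal P_2(\mathbb R^d)$ let $W_2^2(\mu,\eta)=\inf_\pi\int|y-x|^2\,\pi(dx,dy)$, where $\pi$ runs over the couplings of $\mu$ and $\eta$. For probability measures write $\eta\le_{\rm cx}\nu$ (convex order) if $\int\phi\,d\eta\le\int\phi\,d\nu$ for each convex $\phi:\mathbb R^d\to\mathbb R$ for which both integrals make sense in $[-\infty,\infty]$. For $\mu,\nu\in\mathcal P_2(\mathbb R^d)$ let $$\mathcal I_\mu^\nu=\Big\{\eta\in\mathcal P_2(\mathbb R^d):\ \eta\le_{\rm cx}\nu,\ W_2^2(\mu,\nu)=W_2^2(\mu,\eta)+\int|y|^2\nu(dy)-\int|z|^2\eta(dz)\Big\},$$ and for $\phi:\mathbb R^d\to\mathbb R$ strictly convex with $\int\phi\,d\nu<\infty$ let $\mathcal I_{\mu,\phi}^\nu$ be the set of the minimizers of $\eta\mapsto\int\phi\,d\eta$ over $\mathcal I_\mu^\nu$. For all $\mu,\nu\in\mathcal P_2(\mathbb R^d)$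 and every such $\phi$, there is exactly one minimizer $\eta_\phi$ of $\eta\mapsto\int|z|^2\eta(dz)$ over $\mathcal I_{\mu,\phi}^\nu$, and the set $\mathcal I_{\mu,|x|^2}^\nu$ has exactly one element $\underline\eta$. With these notations, there exists $\eta_0\in\mathcal P_2(\mathbb R^d)$ such that $\mathcal I_\mu^\nu=\{\eta:\ \eta_0\le_{\rm cx}\eta\le_{\rm cx}\nu\}$ if and only if $$\Big\{\eta_\phi:\ \phi:\mathbb R^d\to\mathbb R\text{ strictly convex with }\int\phi\,d\nu<\infty\Big\}=\{\underline\eta\},$$ and in that case $\eta_0=\underline\eta$. -/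

import Mathlib

open MeasureTheory
open scoped ENNReal

namespace QuadOT

/-- The Euclidean space `ℝ^d`. -/
abbrev E (d : ℕ) : Type := EuclideanSpace ℝ (Fin d)

/-- `P₂(ℝ^d)`: Borel probability measures on `ℝ^d` with finite second order moment. -/
def P2 (d : ℕ) : Set (Measure (E d)) :=
  {μ | IsProbabilityMeasure μ ∧ ∫⁻ x, ‖x‖ₑ ^ 2 ∂μ < ∞}

/-- `Π(μ, ν)`: measures on `ℝ^d × ℝ^d` with first marginal `μ` and second marginal `ν`. -/
def couplings {d : ℕ} (μ ν : Measure (E d)) : Set (Measure (E d × E d)) :=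
  {π | π.fst = μ ∧ π.snd = ν}

/-- The squared quadratic Wasserstein distance
`W₂²(μ, ν) = inf_{π ∈ Π(μ, ν)} ∫ |y - x|² π(dx, dy)`. -/
noncomputable def W2sq {d : ℕ} (μ ν : Measure (E d)) : ℝ≥0∞ :=
  ⨅ π ∈ couplings μ ν, ∫⁻ p, ‖p.2 - p.1‖ₑ ^ 2 ∂π

/-- The integral `∫ φ dη` makes sense in `[-∞, ∞]`: the positive or the negative part of `φ`
has a finite integral. -/
def IntegralMakesSense {d : ℕ} (η : Measure (E d)) (φ : E d → ℝ) : Prop :=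
  ∫⁻ x, ENNReal.ofReal (φ x) ∂η < ∞ ∨ ∫⁻ x, ENNReal.ofReal (-φ x) ∂η < ∞

/-- The integral `∫ φ dη ∈ [-∞, ∞]`, as the integral of the positive part minus the integral of
the negative part (meaningful under `IntegralMakesSense η φ`). -/
noncomputable def extIntegral {d : ℕ} (η : Measure (E d)) (φ : E d → ℝ) : EReal :=
  ((∫⁻ x, ENNReal.ofReal (φ x) ∂η : ℝ≥0∞) : EReal) -
    ((∫⁻ x, ENNReal.ofReal (-φ x) ∂η : ℝ≥0∞) : EReal)

/-- The convex order `η ≤_cx ν`: `∫ φ dη ≤ ∫ φ dν` for each convex `φ : ℝ^d → ℝ` for which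
both integrals make sense. -/
def CxLE {d : ℕ} (η ν : Measure (E d)) : Prop :=
  ∀ φ : E d → ℝ, ConvexOn ℝ Set.univ φ → IntegralMakesSense η φ → IntegralMakesSense ν φ →
    extIntegral η φ ≤ extIntegral ν φ

/-- The set `𝓘_μ^ν` of all `η ∈ P₂(ℝ^d)` with `η ≤_cx ν` and
`W₂²(μ, ν) = W₂²(μ, η) + ∫ |y|² ν(dy) - ∫ |z|² η(dz)`. -/
def I {d : ℕ} (μ ν : Measure (E d)) : Set (Measure (E d)) :=
  {η | η ∈ P2 d ∧ CxLE η ν ∧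
    (W2sq μ ν).toReal = (W2sq μ η).toReal + ∫ y, ‖y‖ ^ 2 ∂ν - ∫ z, ‖z‖ ^ 2 ∂η}

/-- The interval `{η : η₀ ≤_cx η ≤_cx ν}` of probability measures for the convex order. -/
def cxInterval {d : ℕ} (η₀ ν : Measure (E d)) : Set (Measure (E d)) :=
  {η | IsProbabilityMeasure η ∧ CxLE η₀ η ∧ CxLE η ν}

/-- The minimizers over a set `S` of measures of the integral of `φ`. -/
def minimizers {d : ℕ} (S : Set (Measure (E d))) (φ : E d → ℝ) : Set (Measure (E d)) :=
  {η | η ∈ S ∧ ∀ η' ∈ S, extIntegral η φ ≤ extIntegral η' φ}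

/-- The set `𝓘_{μ,φ}^ν` of the elements of `𝓘_μ^ν` that minimize the integral of `φ`. -/
def Iphi {d : ℕ} (μ ν : Measure (E d)) (φ : E d → ℝ) : Set (Measure (E d)) :=
  minimizers (I μ ν) φ

/-- `φ : ℝ^d → ℝ` is strictly convex and `∫ φ dν < ∞`. (For `ν ∈ P₂(ℝ^d)` the negative part of
a convex function always has a finite integral, so only the positive part matters.) -/
def Admissible {d : ℕ} (ν : Measure (E d)) (φ : E d → ℝ) : Prop :=
  StrictConvexOn ℝ Set.univ φ ∧ ∫⁻ y, ENNReal.ofReal (φ y) ∂ν < ∞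

/-- `η` is the measure `η_φ`: it belongs to `𝓘_{μ,φ}^ν` and it minimizes the second order
moment over `𝓘_{μ,φ}^ν`. -/
def IsEtaPhi {d : ℕ} (μ ν : Measure (E d)) (φ : E d → ℝ) (η : Measure (E d)) : Prop :=
  η ∈ minimizers (Iphi μ ν φ) (fun z => ‖z‖ ^ 2)

end QuadOT

open QuadOT

namespace QuadOT

open Set Filter Topology

variable {d : ℕ}

/-! Expanding the square turns `W2sq` into second moments minus twice the maximal correlation `∫ ⟨x,
z⟩ dπ` over couplings. The second moments cancel in the identity defining `I μ ν`, so membership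
says that `η ≤_cx ν` and that `μ` and `η` have the same maximal correlation as `μ` and `ν`
(`mem_I_iff`). The maximal correlation is monotone in the convex order
(`PosCx.exists_coupling_corr_le`), hence `I μ ν` contains every measure lying between one of its
elements and `ν`.

For admissible `φ` the integral of `φ` has exactly one minimizer on `I μ ν`
(`exists_Iphi_eq_singleton`). Existence comes from weak compactness of couplings with uniformly
integrable squared norms, uniqueness from strict convexity along midpoints of glued couplings
(`exists_midpoint_mem_I`). Thus `Iphi μ ν φ` is already the singleton of `η_φ`, and the further
minimization of the second moment selects nothing.

If `I μ ν` is an interval, its lower end minimizes every `φ`, so all `η_φ` coincide with it.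
Conversely, a common minimizer of all admissible `φ` lies below each element of `I μ ν`, because
strictly convex `ν`-integrable functions suffice to test the convex order
(`posCx_of_strictConvexOn`); monotonicity of the correlation then fills the interval
(`I_eq_cxInterval`). -/

/-! ### Convex functions, affine minorants and second moments. -/

theorem continuous_of_convexOn {φ : E d → ℝ} (h : ConvexOn ℝ univ φ) : Continuous φ :=
  continuousOn_univ.1 (h.continuousOn isOpen_univ)

theorem exists_affine_le {φ : E d → ℝ} (h : ConvexOn ℝ univ φ) :
    ∃ (L : E d →L[ℝ] ℝ) (c : ℝ), ∀ x, L x + c ≤ φ x := by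
  obtain ⟨l, c, hl, -⟩ := h.real_univ_sSup_of_nat_affine_eq
    (continuous_of_convexOn h).lowerSemicontinuous
  exact ⟨l 0, c 0, fun x => hl 0 x⟩

theorem convexOn_affine (L : E d →L[ℝ] ℝ) (c : ℝ) : ConvexOn ℝ univ (fun x => L x + c) :=
  (L.toLinearMap.convexOn convex_univ).add_const c

theorem strictConvexOn_norm_sq : StrictConvexOn ℝ univ (fun x : E d => ‖x‖ ^ 2) := by
  refine ⟨convex_univ, fun x _ y _ hxy a b ha hb hab => ?_⟩
  have hpos : 0 < ‖x - y‖ ^ 2 := by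
    have := norm_pos_iff.2 (sub_ne_zero.2 hxy)
    positivity
  have key : ‖a • x + b • y‖ ^ 2 = a * ‖x‖ ^ 2 + b * ‖y‖ ^ 2 - a * b * ‖x - y‖ ^ 2 := by
    rw [norm_add_sq_real, norm_sub_sq_real, norm_smul, norm_smul, real_inner_smul_left,
      real_inner_smul_right, mul_pow, mul_pow, Real.norm_eq_abs, Real.norm_eq_abs, sq_abs, sq_abs]
    obtain rfl : b = 1 - a := by linarith
    ring
  simp only [key, smul_eq_mul]
  nlinarith [mul_pos (mul_pos ha hb) hpos]

theorem lintegral_norm_sq (μ : Measure (E d)) :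
    ∫⁻ x, ‖x‖ₑ ^ 2 ∂μ = ∫⁻ x, ENNReal.ofReal (‖x‖ ^ 2) ∂μ := by
  refine lintegral_congr fun x => ?_
  rw [ENNReal.ofReal_pow (norm_nonneg _), ofReal_norm]

theorem integrable_norm_sq {μ : Measure (E d)} (hμ : μ ∈ P2 d) :
    Integrable (fun x => ‖x‖ ^ 2) μ := by
  refine ⟨by fun_prop, ?_⟩
  rw [hasFiniteIntegral_iff_ofReal (Eventually.of_forall fun x => by positivity),
    ← lintegral_norm_sq]
  exact hμ.2

theorem integrable_norm {μ : Measure (E d)} (hμ : μ ∈ P2 d) :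
    Integrable (fun x => ‖x‖) μ := by
  have := hμ.1
  refine ((integrable_const (1 : ℝ)).add (integrable_norm_sq hμ)).mono' (by fun_prop)
    (Eventually.of_forall fun x => ?_)
  simp only [norm_norm, Pi.add_apply]
  nlinarith [sq_nonneg (‖x‖ - 1)]

theorem integrable_affine {μ : Measure (E d)} (hμ : μ ∈ P2 d) (L : E d →L[ℝ] ℝ) (c : ℝ) :
    Integrable (fun x => L x + c) μ := by
  have := hμ.1
  refine Integrable.add ?_ (integrable_const c)
  exact ((integrable_norm hμ).const_mul ‖L‖).mono' (by fun_prop)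
    (Eventually.of_forall fun x => L.le_opNorm x)

/-! ### The convex order tested on nonnegative functions. -/

/-- Comparison of the integrals of all nonnegative convex functions. For measures with finite
second order moment this is the convex order. -/
def PosCx (η ν : Measure (E d)) : Prop :=
  ∀ φ : E d → ℝ, ConvexOn ℝ univ φ → (∀ x, 0 ≤ φ x) →
    ∫⁻ x, ENNReal.ofReal (φ x) ∂η ≤ ∫⁻ x, ENNReal.ofReal (φ x) ∂ν

theorem extIntegral_of_nonneg (η : Measure (E d)) {φ : E d → ℝ} (h : ∀ x, 0 ≤ φ x) :
    extIntegral η φ = ((∫⁻ x, ENNReal.ofReal (φ x) ∂η : ℝ≥0∞) : EReal) := by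
  have : ∀ x, ENNReal.ofReal (-φ x) = 0 := fun x => ENNReal.ofReal_eq_zero.2 (by linarith [h x])
  simp [extIntegral, this]

theorem integralMakesSense_of_nonneg (η : Measure (E d)) {φ : E d → ℝ} (h : ∀ x, 0 ≤ φ x) :
    IntegralMakesSense η φ := by
  have : ∀ x, ENNReal.ofReal (-φ x) = 0 := fun x => ENNReal.ofReal_eq_zero.2 (by linarith [h x])
  exact Or.inr (by simp [this])

theorem CxLE.posCx {η ν : Measure (E d)} (h : CxLE η ν) : PosCx η ν := by
  intro φ hφ h0
  have := h φ hφ (integralMakesSense_of_nonneg η h0) (integralMakesSense_of_nonneg ν h0)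
  rwa [extIntegral_of_nonneg η h0, extIntegral_of_nonneg ν h0,
    EReal.coe_ennreal_le_coe_ennreal_iff] at this

theorem PosCx.refl (η : Measure (E d)) : PosCx η η := fun _ _ _ => le_rfl

theorem PosCx.mem_P2 {η ν : Measure (E d)} (h : PosCx η ν) (hη : IsProbabilityMeasure η)
    (hν : ν ∈ P2 d) : η ∈ P2 d := by
  refine ⟨hη, ?_⟩
  have := h _ strictConvexOn_norm_sq.convexOn (fun x => by positivity)
  rw [← lintegral_norm_sq, ← lintegral_norm_sq] at this
  exact this.trans_lt hν.2

theorem PosCx.integral_le {η ν : Measure (E d)} (h : PosCx η ν) {φ : E d → ℝ}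
    (hφ : ConvexOn ℝ univ φ) (h0 : ∀ x, 0 ≤ φ x) (hν : Integrable φ ν) :
    ∫ x, φ x ∂η ≤ ∫ x, φ x ∂ν := by
  have hm := (continuous_of_convexOn hφ).aestronglyMeasurable (μ := η)
  rw [integral_eq_lintegral_of_nonneg_ae (Eventually.of_forall h0) hm,
    integral_eq_lintegral_of_nonneg_ae (Eventually.of_forall h0) hν.1]
  refine ENNReal.toReal_mono ?_ (h φ hφ h0)
  have := hν.2
  rw [hasFiniteIntegral_iff_ofReal (Eventually.of_forall h0)] at this
  exact this.ne

/-- A linear function is not bounded below, so it is replaced by a nonnegative convex function,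
obtained by adding a small multiple of the squared norm and a constant; the multiple then tends to
zero. -/
theorem PosCx.integral_linear_le {η ν : Measure (E d)} (h : PosCx η ν) (hη : η ∈ P2 d)
    (hν : ν ∈ P2 d) (L : E d →L[ℝ] ℝ) : ∫ x, L x ∂η ≤ ∫ x, L x ∂ν := by
  have := hη.1
  have := hν.1
  have hL : ∀ {ρ : Measure (E d)}, ρ ∈ P2 d → Integrable (fun x => L x) ρ := fun hρ => by
    simpa using integrable_affine hρ L 0
  have key : ∀ ε : ℝ, 0 < ε → ∫ x, L x ∂η ≤ ∫ x, L x ∂ν + ε * ∫ x, ‖x‖ ^ 2 ∂ν := by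
    intro ε hε
    -- The constant that completes the square in `ε * ‖x‖ ^ 2 - ‖L‖ * ‖x‖`. It cancels later because
    -- both measures have mass one.
    set C := ‖L‖ ^ 2 / (4 * ε) with hC
    have h0 : ∀ x, 0 ≤ ε * ‖x‖ ^ 2 + (L x + C) := by
      intro x
      have h1 := neg_abs_le (L x)
      have h2 : |L x| ≤ ‖L‖ * ‖x‖ := L.le_opNorm x
      have h3 : ε * ‖x‖ ^ 2 - ‖L‖ * ‖x‖ + C = ε * (‖x‖ - ‖L‖ / (2 * ε)) ^ 2 := by
        rw [hC]; field_simp; ring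
      have h4 : 0 ≤ ε * (‖x‖ - ‖L‖ / (2 * ε)) ^ 2 := by positivity
      linarith
    have hint : ∀ {ρ : Measure (E d)}, ρ ∈ P2 d →
        Integrable (fun x => ε * ‖x‖ ^ 2 + (L x + C)) ρ := fun hρ =>
      ((integrable_norm_sq hρ).const_mul ε).add (integrable_affine hρ L C)
    have := h.integral_le ((strictConvexOn_norm_sq.convexOn.smul hε.le).add (convexOn_affine L C))
      h0 (hint hν)
    simp only [Pi.add_apply, smul_eq_mul] at this
    have heval : ∀ {ρ : Measure (E d)}, ρ ∈ P2 d →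
        ∫ x, (ε * ‖x‖ ^ 2 + (L x + C)) ∂ρ = ε * ∫ x, ‖x‖ ^ 2 ∂ρ + (∫ x, L x ∂ρ + C) := by
      intro ρ hρ
      have := hρ.1
      rw [integral_add ((integrable_norm_sq hρ).const_mul ε) (integrable_affine hρ L C),
        integral_const_mul, integral_add (hL hρ) (integrable_const C)]
      simp
    rw [heval hη, heval hν] at this
    have : 0 ≤ ε * ∫ x, ‖x‖ ^ 2 ∂η := mul_nonneg hε.le (integral_nonneg fun x => by positivity)
    linarith
  have hlim : Tendsto (fun ε : ℝ => ∫ x, L x ∂ν + ε * ∫ x, ‖x‖ ^ 2 ∂ν) (𝓝[>] 0)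
      (𝓝 (∫ x, L x ∂ν + 0 * ∫ x, ‖x‖ ^ 2 ∂ν)) :=
    (Continuous.tendsto (by fun_prop) 0).mono_left nhdsWithin_le_nhds
  rw [zero_mul, add_zero] at hlim
  exact ge_of_tendsto hlim (eventually_mem_nhdsWithin.mono fun ε hε => key ε hε)

theorem PosCx.integral_affine_eq {η ν : Measure (E d)} (h : PosCx η ν) (hη : η ∈ P2 d)
    (hν : ν ∈ P2 d) (L : E d →L[ℝ] ℝ) (c : ℝ) :
    ∫ x, (L x + c) ∂η = ∫ x, (L x + c) ∂ν := by
  have := hη.1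
  have := hν.1
  have h1 := h.integral_linear_le hη hν L
  have h2 := h.integral_linear_le hη hν (-L)
  simp only [neg_apply, integral_neg] at h2
  have hL : ∀ {ρ : Measure (E d)}, ρ ∈ P2 d → Integrable (fun x => L x) ρ := fun hρ => by
    simpa using integrable_affine hρ L 0
  rw [integral_add (hL hη) (integrable_const c), integral_add (hL hν) (integrable_const c)]
  simp
  linarith

/-- Splitting off an affine minorant leaves a nonnegative convex function. Since affine integrals
agree for comparable measures, comparisons of extended integrals reduce to `lintegral`s. -/
theorem extIntegral_eq_add {η : Measure (E d)} (hη : η ∈ P2 d) {φ : E d → ℝ}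
    (hφ : ConvexOn ℝ univ φ) {L : E d →L[ℝ] ℝ} {c : ℝ} (hL : ∀ x, L x + c ≤ φ x) :
    extIntegral η φ = ((∫⁻ x, ENNReal.ofReal (φ x - (L x + c)) ∂η : ℝ≥0∞) : EReal) +
      ((∫ x, (L x + c) ∂η : ℝ) : EReal) := by
  have hm : AEStronglyMeasurable φ η := (continuous_of_convexOn hφ).aestronglyMeasurable
  have hi := integrable_affine hη L c
  have hneg : ∫⁻ x, ENNReal.ofReal (-φ x) ∂η < ∞ := by
    refine lt_of_le_of_lt (lintegral_mono fun x => ENNReal.ofReal_le_ofReal ?_)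
      hi.neg.lintegral_lt_top
    simpa using hL x
  by_cases hpos : ∫⁻ x, ENNReal.ofReal (φ x) ∂η < ∞
  · have hint : Integrable φ η := by
      refine ⟨hm, ?_⟩
      rw [hasFiniteIntegral_iff_norm]
      refine lt_of_le_of_lt (lintegral_mono fun x => ?_)
        (b := ∫⁻ x, (ENNReal.ofReal (φ x) + ENNReal.ofReal (-φ x)) ∂η) ?_
      · rcases le_total 0 (φ x) with h | h
        · rw [Real.norm_of_nonneg h]; exact le_self_add
        · rw [Real.norm_of_nonpos h]; exact le_add_self
      · rw [lintegral_add_left' hm.aemeasurable.ennreal_ofReal]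
        exact ENNReal.add_lt_top.2 ⟨hpos, hneg⟩
    have h1 : extIntegral η φ = ((∫ x, φ x ∂η : ℝ) : EReal) := by
      rw [integral_eq_lintegral_pos_part_sub_lintegral_neg_part hint, EReal.coe_sub,
        EReal.coe_ennreal_toReal hpos.ne, EReal.coe_ennreal_toReal hneg.ne]
      rfl
    have h2 := ofReal_integral_eq_lintegral_ofReal (hint.sub hi)
      (Eventually.of_forall fun x => by simpa using hL x)
    simp only [Pi.sub_apply] at h2
    rw [h1, ← h2, integral_sub hint hi,
      EReal.coe_ennreal_ofReal, max_eq_left (sub_nonneg.2 (integral_mono hi hint hL)),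
      ← EReal.coe_add, sub_add_cancel]
  -- When the positive part has infinite integral, both sides are `⊤`, as the affine and negative
  -- parts contribute only finite amounts.
  · have hpos' := not_lt_top_iff.1 hpos
    have h2 : ∫⁻ x, ENNReal.ofReal (φ x - (L x + c)) ∂η = ∞ := by
      by_contra hne
      refine hpos (lt_of_le_of_lt (lintegral_mono fun x => ?_)
        (b := ∫⁻ x, (ENNReal.ofReal (φ x - (L x + c)) + ENNReal.ofReal (L x + c)) ∂η) ?_)
      · simpa using ENNReal.ofReal_add_le (p := φ x - (L x + c)) (q := L x + c)
      · rw [lintegral_add_right' _ hi.1.aemeasurable.ennreal_ofReal]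
        exact ENNReal.add_lt_top.2 ⟨lt_top_iff_ne_top.2 hne, hi.lintegral_lt_top⟩
    rw [extIntegral, hpos', h2]
    lift ∫⁻ x, ENNReal.ofReal (-φ x) ∂η to NNReal using hneg.ne with r
    rw [EReal.coe_ennreal_top, EReal.top_add_coe]
    exact EReal.top_sub_coe _

theorem PosCx.cxLE {η ν : Measure (E d)} (h : PosCx η ν) (hη : η ∈ P2 d) (hν : ν ∈ P2 d) :
    CxLE η ν := by
  intro φ hφ _ _
  obtain ⟨L, c, hL⟩ := exists_affine_le hφ
  rw [extIntegral_eq_add hη hφ hL, extIntegral_eq_add hν hφ hL, h.integral_affine_eq hη hν]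
  refine add_le_add_left (EReal.coe_ennreal_le_coe_ennreal_iff.2 ?_) _
  exact h _ (hφ.sub ((L.toLinearMap.concaveOn convex_univ).add_const c)) fun x => sub_nonneg.2 (hL x)

theorem PosCx.integral_le_of_integrable {η ν : Measure (E d)} (h : PosCx η ν) (hη : η ∈ P2 d)
    (hν : ν ∈ P2 d) {φ : E d → ℝ} (hφ : ConvexOn ℝ univ φ) (hiη : Integrable φ η)
    (hiν : Integrable φ ν) : ∫ x, φ x ∂η ≤ ∫ x, φ x ∂ν := by
  obtain ⟨L, c, hL⟩ := exists_affine_le hφ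
  have h1 := h.integral_le (φ := fun x => φ x - (L x + c))
    (hφ.sub ((L.toLinearMap.concaveOn convex_univ).add_const c)) (fun x => sub_nonneg.2 (hL x))
    (hiν.sub (integrable_affine hν L c))
  rw [integral_sub hiη (integrable_affine hη L c), integral_sub hiν (integrable_affine hν L c),
    h.integral_affine_eq hη hν] at h1
  linarith

/-- The convex order can be tested on strictly convex functions which are integrable with respect
to a given measure. -/
theorem posCx_of_strictConvexOn {η₁ η₂ ν : Measure (E d)} (hη₂ : η₂ ∈ P2 d)
    (hν : ν ∈ P2 d) (h : ∀ ψ : E d → ℝ, StrictConvexOn ℝ univ ψ → (∀ x, 0 ≤ ψ x) →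
      ∫⁻ x, ENNReal.ofReal (ψ x) ∂ν < ∞ →
      ∫⁻ x, ENNReal.ofReal (ψ x) ∂η₁ ≤ ∫⁻ x, ENNReal.ofReal (ψ x) ∂η₂) : PosCx η₁ η₂ := by
  -- Adding `ε * ‖x‖ ^ 2` makes `ψ` strictly convex and keeps it `ν`-integrable; the extra term
  -- vanishes as `ε → 0` because `η₂` has finite second moment.
  have step : ∀ ψ : E d → ℝ, ConvexOn ℝ univ ψ → (∀ x, 0 ≤ ψ x) →
      ∫⁻ x, ENNReal.ofReal (ψ x) ∂ν < ∞ →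
      ∫⁻ x, ENNReal.ofReal (ψ x) ∂η₁ ≤ ∫⁻ x, ENNReal.ofReal (ψ x) ∂η₂ := by
    intro ψ hψ h0 hfin
    have hm : Measurable fun x => ENNReal.ofReal (ψ x) :=
      (continuous_of_convexOn hψ).measurable.ennreal_ofReal
    have hsplit : ∀ (ε : ℝ), 0 ≤ ε → ∀ ρ : Measure (E d),
        ∫⁻ x, ENNReal.ofReal (ψ x + ε * ‖x‖ ^ 2) ∂ρ =
        ∫⁻ x, ENNReal.ofReal (ψ x) ∂ρ + ENNReal.ofReal ε * ∫⁻ x, ‖x‖ₑ ^ 2 ∂ρ := by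
      intro ε hε ρ
      rw [lintegral_norm_sq, ← lintegral_const_mul _ (by fun_prop), ← lintegral_add_left hm]
      refine lintegral_congr fun x => ?_
      rw [ENNReal.ofReal_add (h0 x) (by positivity), ENNReal.ofReal_mul hε]
    have key : ∀ ε : ℝ, 0 < ε → ∫⁻ x, ENNReal.ofReal (ψ x) ∂η₁ ≤
        ∫⁻ x, ENNReal.ofReal (ψ x) ∂η₂ + ENNReal.ofReal ε * ∫⁻ x, ‖x‖ₑ ^ 2 ∂η₂ := by
      intro ε hε
      have hs : StrictConvexOn ℝ univ (fun x => ψ x + ε * ‖x‖ ^ 2) := by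
        refine hψ.add_strictConvexOn ⟨convex_univ, fun x hx y hy hxy a b ha hb hab => ?_⟩
        have := strictConvexOn_norm_sq.2 hx hy hxy ha hb hab
        simp only [smul_eq_mul] at this ⊢
        nlinarith
      have := h _ hs (fun x => add_nonneg (h0 x) (by positivity)) (by
        rw [hsplit ε hε.le]
        exact ENNReal.add_lt_top.2 ⟨hfin, ENNReal.mul_lt_top ENNReal.ofReal_lt_top hν.2⟩)
      rw [hsplit ε hε.le, hsplit ε hε.le] at this
      exact le_self_add.trans this
    have hlim : Tendsto (fun ε : ℝ => ∫⁻ x, ENNReal.ofReal (ψ x) ∂η₂ +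
        ENNReal.ofReal ε * ∫⁻ x, ‖x‖ₑ ^ 2 ∂η₂) (𝓝[>] 0)
        (𝓝 (∫⁻ x, ENNReal.ofReal (ψ x) ∂η₂ + ENNReal.ofReal 0 * ∫⁻ x, ‖x‖ₑ ^ 2 ∂η₂)) := by
      refine Tendsto.mono_left ?_ nhdsWithin_le_nhds
      refine tendsto_const_nhds.add (ENNReal.Tendsto.mul_const ?_ (Or.inr hη₂.2.ne))
      exact (ENNReal.continuous_ofReal.tendsto 0)
    rw [ENNReal.ofReal_zero, zero_mul, add_zero] at hlim
    exact ge_of_tendsto hlim (eventually_mem_nhdsWithin.mono fun ε hε => key ε hε)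
  intro φ hφ h0
  obtain ⟨l, c, hl, hsup⟩ := hφ.real_univ_sSup_of_nat_affine_eq
    (continuous_of_convexOn hφ).lowerSemicontinuous
  have hl' : ∀ i x, l i x + c i ≤ φ x := fun i x => hl i x
  -- Running maxima of `0` and countably many affine minorants increase to `φ`. Each is
  -- `ν`-integrable even when `φ` is not, so `step` applies and monotone convergence concludes.
  let f : ℕ → E d → ℝ := fun n => n.rec (fun _ => 0) fun k g x => max (g x) (l k x + c k)
  have hf0 : ∀ x, f 0 x = 0 := fun _ => rfl
  have hfs : ∀ n x, f (n + 1) x = max (f n x) (l n x + c n) := fun _ _ => rfl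
  have hfconv : ∀ n, ConvexOn ℝ univ (f n) := by
    intro n
    induction n with
    | zero => exact convexOn_const 0 convex_univ
    | succ n ih => exact ih.sup (convexOn_affine (l n) (c n))
  have hfmono : ∀ x, Monotone fun n => f n x := fun x =>
    monotone_nat_of_le_succ fun n => by rw [hfs]; exact le_max_left _ _
  have hfnn : ∀ n x, 0 ≤ f n x := fun n x => hfmono x (Nat.zero_le n)
  have hfle : ∀ n x, f n x ≤ φ x := by
    intro n x
    induction n with
    | zero => exact h0 x
    | succ n ih => rw [hfs]; exact max_le ih (hl' n x)
  have hfint : ∀ n, Integrable (f n) ν := by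
    intro n
    have := hν.1
    induction n with
    | zero => exact integrable_const 0
    | succ n ih => exact ih.sup (integrable_affine hν (l n) (c n))
  have hfsup : ∀ x, ⨆ n, ENNReal.ofReal (f n x) = ENNReal.ofReal (φ x) := by
    intro x
    refine le_antisymm (iSup_le fun n => ENNReal.ofReal_le_ofReal (hfle n x)) ?_
    refine le_of_forall_lt fun a ha => ?_
    obtain ⟨b, hbn, rfl⟩ : ∃ b, 0 ≤ b ∧ a = ENNReal.ofReal b := ⟨a.toReal,
      ENNReal.toReal_nonneg, (ENNReal.ofReal_toReal (ha.trans ENNReal.ofReal_lt_top).ne).symm⟩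
    have hb : b < φ x := (ENNReal.ofReal_lt_ofReal_iff'.1 ha).1
    have hx : φ x = ⨆ i, (l i x + c i) := by
      rw [← hsup, iSup_apply]; rfl
    rw [hx] at hb
    obtain ⟨i, hi⟩ := exists_lt_of_lt_ciSup hb
    refine lt_of_lt_of_le ?_ (le_iSup _ (i + 1))
    have h2 := hfs i x ▸ le_max_right (f i x) (l i x + c i)
    exact (ENNReal.ofReal_lt_ofReal_iff_of_nonneg hbn).2 (hi.trans_le h2)
  have hmeas : ∀ n, Measurable fun x => ENNReal.ofReal (f n x) := fun n =>
    (continuous_of_convexOn (hfconv n)).measurable.ennreal_ofReal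
  have hmon : Monotone fun n x => ENNReal.ofReal (f n x) := fun m n hmn x =>
    ENNReal.ofReal_le_ofReal (hfmono x hmn)
  simp_rw [← hfsup]
  rw [lintegral_iSup hmeas hmon, lintegral_iSup hmeas hmon]
  exact iSup_mono fun n => step _ (hfconv n) (hfnn n) (hfint n).lintegral_lt_top

/-! ### Uniform integrability and tightness. -/

/-- The excess function `(|x| - R)₊²`. -/
noncomputable def excess (R : ℝ) (x : E d) : ℝ := max (‖x‖ - R) 0 ^ 2

theorem excess_nonneg (R : ℝ) (x : E d) : 0 ≤ excess R x := by
  unfold excess; positivity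

theorem continuous_excess (R : ℝ) : Continuous (excess R : E d → ℝ) := by
  unfold excess; fun_prop

theorem convexOn_excess (R : ℝ) : ConvexOn ℝ univ (excess R : E d → ℝ) := by
  have h : ConvexOn ℝ univ (fun x : E d => max (‖x‖ - R) 0) := by
    have := ((convexOn_norm (E := E d) convex_univ).add_const (-R)).sup
      (convexOn_const 0 convex_univ)
    simpa [sub_eq_add_neg] using! this
  exact h.pow (fun x _ => le_max_right _ _) 2

theorem excess_anti {R R' : ℝ} (h : R ≤ R') (x : E d) : excess R' x ≤ excess R x := by
  unfold excess
  gcongr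

theorem excess_le {R : ℝ} (hR : 0 ≤ R) (x : E d) : excess R x ≤ ‖x‖ ^ 2 := by
  unfold excess
  gcongr
  exact max_le (by linarith) (norm_nonneg x)

theorem norm_sq_le_excess (R : ℝ) (x : E d) : ‖x‖ ^ 2 ≤ 2 * R ^ 2 + 2 * excess R x := by
  unfold excess
  rcases le_total (‖x‖ - R) 0 with h | h
  · rw [max_eq_right h]
    nlinarith [norm_nonneg x]
  · rw [max_eq_left h]
    nlinarith [sq_nonneg (‖x‖ - 2 * R)]

/-- Uniform integrability of the squared norm along a sequence of measures. -/
def UI2 (s : ℕ → Measure (E d)) : Prop :=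
  ∀ ε : ℝ, 0 < ε → ∃ R : ℝ, 0 ≤ R ∧ ∀ n, ∫⁻ x, ENNReal.ofReal (excess R x) ∂(s n) ≤ ENNReal.ofReal ε

theorem exists_excess_le {ν : Measure (E d)} (hν : ν ∈ P2 d) {ε : ℝ} (hε : 0 < ε) :
    ∃ R : ℝ, 0 ≤ R ∧ ∫⁻ x, ENNReal.ofReal (excess R x) ∂ν ≤ ENNReal.ofReal ε := by
  have hlim : Tendsto (fun n : ℕ => ∫⁻ x, ENNReal.ofReal (excess (n : ℝ) x) ∂ν) atTop
      (𝓝 (∫⁻ _, 0 ∂ν)) := by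
    refine tendsto_lintegral_of_dominated_convergence (fun x => ENNReal.ofReal (‖x‖ ^ 2))
      (fun n => (continuous_excess _).measurable.ennreal_ofReal)
      (fun n => Eventually.of_forall fun x =>
        ENNReal.ofReal_le_ofReal (excess_le (Nat.cast_nonneg n) x)) ?_
      (Eventually.of_forall fun x => ?_)
    · rw [← lintegral_norm_sq]; exact hν.2.ne
    · refine tendsto_const_nhds.congr' ?_
      obtain ⟨N, hN⟩ := exists_nat_ge ‖x‖
      filter_upwards [eventually_ge_atTop N] with n hn
      have : ‖x‖ - n ≤ 0 := sub_nonpos.2 (hN.trans (by exact_mod_cast hn))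
      simp [excess, max_eq_right this]
  rw [lintegral_zero] at hlim
  obtain ⟨n, hn⟩ := (hlim.eventually (ge_mem_nhds (ENNReal.ofReal_pos.2 hε))).exists
  exact ⟨n, Nat.cast_nonneg n, hn⟩

/-- The excess functions are convex and nonnegative, so domination in the convex order transfers a
tail bound from `ν` to every term. -/
theorem UI2.of_posCx {s : ℕ → Measure (E d)} {ν : Measure (E d)} (hν : ν ∈ P2 d)
    (h : ∀ n, PosCx (s n) ν) : UI2 s := by
  intro ε hε
  obtain ⟨R, hR, hle⟩ := exists_excess_le hν hε
  exact ⟨R, hR, fun n => (h n _ (convexOn_excess R) (excess_nonneg R)).trans hle⟩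

theorem UI2.const {ν : Measure (E d)} (hν : ν ∈ P2 d) : UI2 fun _ => ν :=
  UI2.of_posCx hν fun _ => PosCx.refl ν

theorem UI2.exists_bound {s : ℕ → Measure (E d)} (h : UI2 s)
    (hs : ∀ n, IsProbabilityMeasure (s n)) :
    ∃ C : ℝ≥0∞, C < ∞ ∧ ∀ n, ∫⁻ x, ‖x‖ₑ ^ 2 ∂(s n) ≤ C := by
  obtain ⟨R, -, hR⟩ := h 1 one_pos
  refine ⟨ENNReal.ofReal (2 * R ^ 2) + ENNReal.ofReal 2 * ENNReal.ofReal 1,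
    ENNReal.add_lt_top.2 ⟨ENNReal.ofReal_lt_top,
      ENNReal.mul_lt_top ENNReal.ofReal_lt_top ENNReal.ofReal_lt_top⟩, fun n => ?_⟩
  have := hs n
  rw [lintegral_norm_sq]
  calc ∫⁻ x, ENNReal.ofReal (‖x‖ ^ 2) ∂(s n)
      ≤ ∫⁻ x, (ENNReal.ofReal (2 * R ^ 2) + ENNReal.ofReal 2 * ENNReal.ofReal (excess R x)) ∂(s n) := by
        refine lintegral_mono fun x => ?_
        rw [← ENNReal.ofReal_mul (by norm_num), ← ENNReal.ofReal_add (by positivity)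
          (mul_nonneg (by norm_num) (excess_nonneg R x))]
        exact ENNReal.ofReal_le_ofReal (norm_sq_le_excess R x)
    _ = ENNReal.ofReal (2 * R ^ 2) + ENNReal.ofReal 2 * ∫⁻ x, ENNReal.ofReal (excess R x) ∂(s n) := by
        rw [lintegral_add_left measurable_const,
          lintegral_const_mul _ (continuous_excess R).measurable.ennreal_ofReal]
        simp
    _ ≤ _ := by gcongr; exact hR n

/-- Markov's inequality for the squared norm. -/
theorem isTightMeasureSet_of_bound {S : Set (Measure (E d))} {C : ℝ≥0∞} (hC : C < ∞)
    (h : ∀ ρ ∈ S, ∫⁻ x, ‖x‖ₑ ^ 2 ∂ρ ≤ C) : IsTightMeasureSet S := by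
  refine isTightMeasureSet_of_tendsto_measure_norm_gt ?_
  have hlim : Tendsto (fun r : ℝ => C / ENNReal.ofReal (r ^ 2)) atTop (𝓝 0) := by
    rw [← ENNReal.div_top (a := C) ]
    · refine ENNReal.Tendsto.const_div ?_ (Or.inr hC.ne)
      exact ENNReal.tendsto_ofReal_atTop.comp (tendsto_pow_atTop two_ne_zero)
  refine tendsto_of_tendsto_of_tendsto_of_le_of_le' tendsto_const_nhds hlim
    (Eventually.of_forall fun _ => zero_le) ?_
  filter_upwards [eventually_gt_atTop 0] with r hr
  refine iSup₂_le fun ρ hρ => ?_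
  have hr2 : ENNReal.ofReal (r ^ 2) ≠ 0 := (ENNReal.ofReal_pos.2 (by positivity)).ne'
  have hm := meas_ge_le_lintegral_div (μ := ρ) (f := fun x : E d => ENNReal.ofReal (‖x‖ ^ 2))
    (by fun_prop) hr2 ENNReal.ofReal_ne_top
  rw [← lintegral_norm_sq] at hm
  refine (measure_mono fun x hx => ?_).trans (hm.trans (ENNReal.div_le_div_right (h ρ hρ) _))
  refine ENNReal.ofReal_le_ofReal ?_
  have : r < ‖x‖ := hx
  gcongr

/-! ### Correlation of a coupling and its upper semicontinuity. -/

/-- The correlation `∫ ⟨x, z⟩ π(dx, dz)`. -/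
noncomputable def corr (π : Measure (E d × E d)) : ℝ := ∫ p, inner ℝ p.1 p.2 ∂π

theorem integrable_fst_comp {π : Measure (E d × E d)} {f : E d → ℝ} (h : Integrable f π.fst) :
    Integrable (fun p : E d × E d => f p.1) π := h.comp_measurable measurable_fst

theorem integrable_snd_comp {π : Measure (E d × E d)} {f : E d → ℝ} (h : Integrable f π.snd) :
    Integrable (fun p : E d × E d => f p.2) π := h.comp_measurable measurable_snd

theorem integral_fst_comp {π : Measure (E d × E d)} {f : E d → ℝ} (h : Integrable f π.fst) :
    ∫ p, f p.1 ∂π = ∫ x, f x ∂π.fst :=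
  (integral_map measurable_fst.aemeasurable h.1).symm

theorem integral_snd_comp {π : Measure (E d × E d)} {f : E d → ℝ} (h : Integrable f π.snd) :
    ∫ p, f p.2 ∂π = ∫ x, f x ∂π.snd :=
  (integral_map measurable_snd.aemeasurable h.1).symm

theorem integrable_inner {π : Measure (E d × E d)} (h₁ : π.fst ∈ P2 d) (h₂ : π.snd ∈ P2 d) :
    Integrable (fun p : E d × E d => inner ℝ p.1 p.2) π := by
  refine ((integrable_fst_comp (integrable_norm_sq h₁)).add
    (integrable_snd_comp (integrable_norm_sq h₂))).mono' (by fun_prop)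
    (Eventually.of_forall fun p => (norm_inner_le_norm p.1 p.2).trans ?_)
  simp only [Pi.add_apply]
  nlinarith [sq_nonneg (‖p.1‖ - ‖p.2‖), sq_nonneg (‖p.1‖), sq_nonneg (‖p.2‖)]

theorem integrable_excess {ρ : Measure (E d)} (h : ρ ∈ P2 d) {R : ℝ} (hR : 0 ≤ R) :
    Integrable (excess R) ρ :=
  (integrable_norm_sq h).mono' (continuous_excess R).aestronglyMeasurable
    (Eventually.of_forall fun x => by
      rw [Real.norm_of_nonneg (excess_nonneg R x)]; exact excess_le hR x)

theorem integral_excess_le {ρ : Measure (E d)} {R ε : ℝ} (hε : 0 ≤ ε)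
    (h : ∫⁻ x, ENNReal.ofReal (excess R x) ∂ρ ≤ ENNReal.ofReal ε) : ∫ x, excess R x ∂ρ ≤ ε := by
  rw [integral_eq_lintegral_of_nonneg_ae (Eventually.of_forall (excess_nonneg R))
    (continuous_excess R).aestronglyMeasurable]
  exact ENNReal.toReal_le_of_le_ofReal hε h

/-- The portmanteau lower semicontinuity for nonnegative continuous integrands, with no boundedness
required. -/
theorem lintegral_le_of_tendsto {Ω : Type*} [MeasurableSpace Ω] [TopologicalSpace Ω]
    [OpensMeasurableSpace Ω] [HasOuterApproxClosed Ω] {ρ : ProbabilityMeasure Ω}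
    {s : ℕ → ProbabilityMeasure Ω} (h : Tendsto s atTop (𝓝 ρ)) {f : Ω → ℝ} (hf : Continuous f)
    (h0 : ∀ x, 0 ≤ f x) {C : ℝ≥0∞}
    (hC : ∀ᶠ n in atTop, ∫⁻ x, ENNReal.ofReal (f x) ∂(s n : Measure Ω) ≤ C) :
    ∫⁻ x, ENNReal.ofReal (f x) ∂(ρ : Measure Ω) ≤ C :=
  (lintegral_le_liminf_lintegral_of_forall_isOpen_measure_le_liminf_measure hf h0
    fun _ hG => ProbabilityMeasure.le_liminf_measure_open_of_tendsto h hG).trans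
    (liminf_le_of_frequently_le' hC.frequently)

theorem inner_le_excess (R : ℝ) (x z : E d) :
    inner ℝ x z ≤ 2 * R ^ 2 + excess R x + excess R z := by
  have := real_inner_le_norm x z
  nlinarith [sq_nonneg (‖x‖ - ‖z‖), norm_sq_le_excess R x, norm_sq_le_excess R z]

/-- The inner product is unbounded, but by `inner_le_excess` it lies below a constant plus two
excess functions of small integral. Lower semicontinuity of the integral of the nonnegative
difference `H` bounds the loss of correlation by `ε`. -/
theorem corr_le_of_tendsto {ρ : ProbabilityMeasure (E d × E d)}
    {s : ℕ → ProbabilityMeasure (E d × E d)} (h : Tendsto s atTop (𝓝 ρ))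
    (h₁ : UI2 fun n => (s n : Measure (E d × E d)).fst)
    (h₂ : UI2 fun n => (s n : Measure (E d × E d)).snd)
    (hs₁ : ∀ n, (s n : Measure (E d × E d)).fst ∈ P2 d)
    (hs₂ : ∀ n, (s n : Measure (E d × E d)).snd ∈ P2 d)
    (hρ₁ : (ρ : Measure (E d × E d)).fst ∈ P2 d) (hρ₂ : (ρ : Measure (E d × E d)).snd ∈ P2 d)
    {c : ℝ} (hc : ∀ δ : ℝ, 0 < δ → ∀ᶠ n in atTop, c - δ ≤ corr (s n : Measure (E d × E d))) :
    c ≤ corr (ρ : Measure (E d × E d)) := by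
  refine le_of_forall_pos_le_add fun ε hε => ?_
  obtain ⟨R₁, hR₁, hle₁⟩ := h₁ (ε / 3) (by positivity)
  obtain ⟨R₂, hR₂, hle₂⟩ := h₂ (ε / 3) (by positivity)
  set R := max R₁ R₂ with hRdef
  have hR : 0 ≤ R := hR₁.trans (le_max_left _ _)
  let H : E d × E d → ℝ := fun p => 2 * R ^ 2 + excess R p.1 + excess R p.2 - inner ℝ p.1 p.2
  have hH0 : ∀ p, 0 ≤ H p := fun p => sub_nonneg.2 (inner_le_excess R p.1 p.2)
  have hHc : Continuous H := by
    have := continuous_excess (d := d) R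
    fun_prop
  have hHint : ∀ π : ProbabilityMeasure (E d × E d), (π : Measure (E d × E d)).fst ∈ P2 d →
      (π : Measure (E d × E d)).snd ∈ P2 d → Integrable H (π : Measure (E d × E d)) ∧
      ∫ p, H p ∂(π : Measure (E d × E d)) = 2 * R ^ 2 +
        ∫ x, excess R x ∂(π : Measure (E d × E d)).fst +
        ∫ x, excess R x ∂(π : Measure (E d × E d)).snd - corr (π : Measure (E d × E d)) := by
    intro π hp₁ hp₂
    have i1 := integrable_fst_comp (integrable_excess hp₁ hR)
    have i2 := integrable_snd_comp (integrable_excess hp₂ hR)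
    have i0 := integrable_const (μ := (π : Measure (E d × E d))) (2 * R ^ 2)
    have i3 := integrable_inner hp₁ hp₂
    have i4 : Integrable (fun p : E d × E d => 2 * R ^ 2 + excess R p.1)
      (π : Measure (E d × E d)) := i0.add i1
    have i5 : Integrable (fun p : E d × E d => 2 * R ^ 2 + excess R p.1 + excess R p.2)
      (π : Measure (E d × E d)) := i4.add i2
    refine ⟨i5.sub i3, ?_⟩
    rw [← integral_fst_comp (integrable_excess hp₁ hR),
      ← integral_snd_comp (integrable_excess hp₂ hR), corr]
    simp only [H]
    rw [integral_sub i5 i3, integral_add i4 i2, integral_add i0 i1]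
    simp
  have hanti : ∀ (r : ℝ), r ≤ R → ∀ ρ : Measure (E d),
      ∫⁻ x, ENNReal.ofReal (excess r x) ∂ρ ≤ ENNReal.ofReal (ε / 3) →
      ∫ x, excess R x ∂ρ ≤ ε / 3 := fun r hr ρ hle =>
    integral_excess_le (by positivity) ((lintegral_mono fun x =>
      ENNReal.ofReal_le_ofReal (excess_anti hr x)).trans hle)
  have hbound := lintegral_le_of_tendsto h hHc hH0
    (C := ENNReal.ofReal (2 * R ^ 2 + ε / 3 + ε / 3 - (c - ε / 3))) (by
      filter_upwards [hc (ε / 3) (by positivity)] with n hn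
      obtain ⟨hi, he⟩ := hHint (s n) (hs₁ n) (hs₂ n)
      rw [← ofReal_integral_eq_lintegral_ofReal hi (Eventually.of_forall hH0), he]
      refine ENNReal.ofReal_le_ofReal ?_
      have a1 := hanti R₁ (le_max_left _ _) _ (hle₁ n)
      have a2 := hanti R₂ (le_max_right _ _) _ (hle₂ n)
      linarith)
  obtain ⟨hi, he⟩ := hHint ρ hρ₁ hρ₂
  rw [← ofReal_integral_eq_lintegral_ofReal hi (Eventually.of_forall hH0), he] at hbound
  have b1 : 0 ≤ ∫ x, excess R x ∂(ρ : Measure (E d × E d)).fst := integral_nonneg (excess_nonneg R)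
  have b2 : 0 ≤ ∫ x, excess R x ∂(ρ : Measure (E d × E d)).snd := integral_nonneg (excess_nonneg R)
  -- `ENNReal.ofReal` truncates at zero, so the real inequality can be read off only once this bound
  -- is known to be nonnegative.
  have b3 : 0 ≤ 2 * R ^ 2 + ε / 3 + ε / 3 - (c - ε / 3) := by
    obtain ⟨n, hn⟩ := (hc (ε / 3) (by positivity)).exists
    obtain ⟨hi, he⟩ := hHint (s n) (hs₁ n) (hs₂ n)
    have a0 : 0 ≤ ∫ p, H p ∂(s n : Measure (E d × E d)) := integral_nonneg hH0
    have a1 := hanti R₁ (le_max_left _ _) _ (hle₁ n)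
    have a2 := hanti R₂ (le_max_right _ _) _ (hle₂ n)
    linarith
  have := (ENNReal.ofReal_le_ofReal_iff b3).1 hbound
  linarith

/-! ### Weak limits of couplings. -/

/-- The first marginal, as a probability measure. -/
noncomputable def pfst (π : ProbabilityMeasure (E d × E d)) : ProbabilityMeasure (E d) :=
  π.map measurable_fst.aemeasurable

/-- The second marginal, as a probability measure. -/
noncomputable def psnd (π : ProbabilityMeasure (E d × E d)) : ProbabilityMeasure (E d) :=
  π.map measurable_snd.aemeasurable

theorem coe_pfst (π : ProbabilityMeasure (E d × E d)) :
    (pfst π : Measure (E d)) = (π : Measure (E d × E d)).fst := rfl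

theorem tendsto_pfst {ρ : ProbabilityMeasure (E d × E d)} {s : ℕ → ProbabilityMeasure (E d × E d)}
    (h : Tendsto s atTop (𝓝 ρ)) : Tendsto (fun n => pfst (s n)) atTop (𝓝 (pfst ρ)) :=
  ProbabilityMeasure.tendsto_map_of_tendsto_of_continuous _ _ h continuous_fst

theorem tendsto_psnd {ρ : ProbabilityMeasure (E d × E d)} {s : ℕ → ProbabilityMeasure (E d × E d)}
    (h : Tendsto s atTop (𝓝 ρ)) : Tendsto (fun n => psnd (s n)) atTop (𝓝 (psnd ρ)) :=
  ProbabilityMeasure.tendsto_map_of_tendsto_of_continuous _ _ h continuous_snd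

theorem mem_P2_of_tendsto {ρ : ProbabilityMeasure (E d)} {s : ℕ → ProbabilityMeasure (E d)}
    (h : Tendsto s atTop (𝓝 ρ)) {C : ℝ≥0∞} (hC : C < ∞)
    (hs : ∀ n, ∫⁻ x, ‖x‖ₑ ^ 2 ∂(s n : Measure (E d)) ≤ C) : (ρ : Measure (E d)) ∈ P2 d := by
  refine ⟨inferInstance, lt_of_le_of_lt ?_ hC⟩
  rw [lintegral_norm_sq]
  refine lintegral_le_of_tendsto h (by fun_prop) (fun x => by positivity)
    (Eventually.of_forall fun n => ?_)
  rw [← lintegral_norm_sq]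
  exact hs n

theorem UI2.comp {s : ℕ → Measure (E d)} (h : UI2 s) (k : ℕ → ℕ) : UI2 fun n => s (k n) := by
  intro ε hε
  obtain ⟨R, hR, hle⟩ := h ε hε
  exact ⟨R, hR, fun n => hle (k n)⟩

/-- Compactness of sequences of couplings with uniformly integrable marginals, together with the
upper semicontinuity of the correlation. -/
theorem exists_subseq_tendsto (s : ℕ → ProbabilityMeasure (E d × E d))
    (h₁ : UI2 fun n => (s n : Measure (E d × E d)).fst)
    (h₂ : UI2 fun n => (s n : Measure (E d × E d)).snd) :
    ∃ (ρ : ProbabilityMeasure (E d × E d)) (k : ℕ → ℕ), StrictMono k ∧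
      Tendsto (fun n => s (k n)) atTop (𝓝 ρ) ∧
      ∀ c : ℝ, (∀ δ : ℝ, 0 < δ → ∀ᶠ n in atTop, c - δ ≤ corr (s n : Measure (E d × E d))) →
        c ≤ corr (ρ : Measure (E d × E d)) := by
  obtain ⟨C₁, hC₁, hb₁⟩ := h₁.exists_bound fun n => inferInstance
  obtain ⟨C₂, hC₂, hb₂⟩ := h₂.exists_bound fun n => inferInstance
  have htight : IsTightMeasureSet {((μ : ProbabilityMeasure (E d × E d)) : Measure (E d × E d)) |
      μ ∈ range s} := by
    refine IsTightMeasureSet.prodMk (isTightMeasureSet_of_bound hC₁ ?_)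
      (isTightMeasureSet_of_bound hC₂ ?_)
    · rintro _ ⟨_, ⟨_, ⟨n, rfl⟩, rfl⟩, rfl⟩
      exact hb₁ n
    · rintro _ ⟨_, ⟨_, ⟨n, rfl⟩, rfl⟩, rfl⟩
      exact hb₂ n
  obtain ⟨ρ, -, k, hk, hlim⟩ := (isCompact_closure_of_isTightMeasureSet htight).isSeqCompact
    (x := s) fun n => subset_closure (mem_range_self n)
  refine ⟨ρ, k, hk, hlim, fun c hc => ?_⟩
  refine corr_le_of_tendsto hlim (h₁.comp k) (h₂.comp k)
    (fun n => ⟨inferInstance, (hb₁ _).trans_lt hC₁⟩)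
    (fun n => ⟨inferInstance, (hb₂ _).trans_lt hC₂⟩)
    (mem_P2_of_tendsto (tendsto_pfst hlim) hC₁ fun n => hb₁ (k n))
    (mem_P2_of_tendsto (tendsto_psnd hlim) hC₂ fun n => hb₂ (k n))
    (fun δ hδ => hk.tendsto_atTop.eventually (hc δ hδ))

theorem posCx_of_tendsto {ρ : ProbabilityMeasure (E d)} {s : ℕ → ProbabilityMeasure (E d)}
    {ν : Measure (E d)} (h : Tendsto s atTop (𝓝 ρ)) (hs : ∀ n, PosCx (s n : Measure (E d)) ν) :
    PosCx (ρ : Measure (E d)) ν := fun φ hφ h0 =>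
  lintegral_le_of_tendsto h (continuous_of_convexOn hφ) h0
    (Eventually.of_forall fun n => hs n φ hφ h0)

theorem eq_of_tendsto_const {ρ : ProbabilityMeasure (E d)} {s : ℕ → ProbabilityMeasure (E d)}
    {μ : Measure (E d)} (h : Tendsto s atTop (𝓝 ρ)) (hs : ∀ n, (s n : Measure (E d)) = μ) :
    (ρ : Measure (E d)) = μ := by
  have h0 : ∀ n, s n = s 0 := fun n => ProbabilityMeasure.toMeasure_injective (by rw [hs, hs])
  have : ρ = s 0 := tendsto_nhds_unique h (tendsto_const_nhds.congr fun n => (h0 n).symm)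
  rw [this, hs]

theorem isProbabilityMeasure_of_mem_couplings {μ ν : Measure (E d)} [IsProbabilityMeasure μ]
    {π : Measure (E d × E d)} (h : π ∈ couplings μ ν) : IsProbabilityMeasure π :=
  ⟨by rw [← Measure.fst_univ, h.1, measure_univ]⟩

theorem prod_mem_couplings (μ ν : Measure (E d)) [IsProbabilityMeasure μ]
    [IsProbabilityMeasure ν] : μ.prod ν ∈ couplings μ ν :=
  ⟨Measure.fst_prod, Measure.snd_prod⟩

-- The common limit argument behind optimal couplings and both approximation steps for monotonicity:
-- the second marginal stays fixed while the first converges weakly.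
open scoped BoundedContinuousFunction in
theorem exists_coupling_of_seq {s : ℕ → Measure (E d × E d)}
    (hs : ∀ n, IsProbabilityMeasure (s n)) {μ ν : Measure (E d)} (hμ : μ ∈ P2 d) (hν : ν ∈ P2 d)
    (h₁ : UI2 fun n => (s n).fst)
    (hlim : ∀ f : E d →ᵇ ℝ, Tendsto (fun n => ∫ x, f x ∂(s n).fst) atTop (𝓝 (∫ x, f x ∂μ)))
    (h₂ : ∀ n, (s n).snd = ν) {c : ℝ}
    (hc : ∀ δ : ℝ, 0 < δ → ∀ᶠ n in atTop, c - δ ≤ corr (s n)) :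
    ∃ ρ ∈ couplings μ ν, c ≤ corr ρ := by
  let t : ℕ → ProbabilityMeasure (E d × E d) := fun n => ⟨s n, hs n⟩
  let m : ProbabilityMeasure (E d) := ⟨μ, hμ.1⟩
  have hlim' : Tendsto (fun n => pfst (t n)) atTop (𝓝 m) :=
    ProbabilityMeasure.tendsto_iff_forall_integral_tendsto.2 hlim
  have h₂' : UI2 fun n => (s n).snd := by simpa only [h₂] using UI2.const hν
  obtain ⟨ρ, k, hk, hρ, hcorr⟩ := exists_subseq_tendsto t h₁ h₂'
  refine ⟨ρ, ⟨?_, ?_⟩, hcorr c hc⟩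
  · rw [← coe_pfst, tendsto_nhds_unique (tendsto_pfst hρ) (hlim'.comp hk.tendsto_atTop)]
    rfl
  · exact eq_of_tendsto_const (tendsto_psnd hρ) fun n => h₂ (k n)

/-! ### Optimal couplings and the Wasserstein distance. -/

theorem corr_le {π : Measure (E d × E d)} (h₁ : π.fst ∈ P2 d) (h₂ : π.snd ∈ P2 d) :
    corr π ≤ ∫ x, ‖x‖ ^ 2 ∂π.fst + ∫ x, ‖x‖ ^ 2 ∂π.snd := by
  have i1 := integrable_fst_comp (integrable_norm_sq h₁)
  have i2 := integrable_snd_comp (integrable_norm_sq h₂)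
  rw [← integral_fst_comp (integrable_norm_sq h₁), ← integral_snd_comp (integrable_norm_sq h₂),
    ← integral_add i1 i2]
  refine integral_mono (integrable_inner h₁ h₂) (i1.add i2) fun p => ?_
  have := real_inner_le_norm p.1 p.2
  simp only
  nlinarith [sq_nonneg (‖p.1‖ - ‖p.2‖), sq_nonneg ‖p.1‖, sq_nonneg ‖p.2‖]

/-- Couplings maximizing the correlation exist. -/
theorem exists_max_corr {μ ν : Measure (E d)} (hμ : μ ∈ P2 d) (hν : ν ∈ P2 d) :
    ∃ π ∈ couplings μ ν, ∀ π' ∈ couplings μ ν, corr π' ≤ corr π := by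
  have := hμ.1
  have := hν.1
  have hne : (corr '' couplings μ ν).Nonempty := ⟨_, _, prod_mem_couplings μ ν, rfl⟩
  have hbdd : BddAbove (corr '' couplings μ ν) := by
    refine ⟨∫ x, ‖x‖ ^ 2 ∂μ + ∫ x, ‖x‖ ^ 2 ∂ν, ?_⟩
    rintro _ ⟨π, ⟨rfl, rfl⟩, rfl⟩
    exact corr_le hμ hν
  obtain ⟨u, -, hu, hmem⟩ := exists_seq_tendsto_sSup hne hbdd
  choose π hπ hcorr using hmem
  have hp : ∀ n, IsProbabilityMeasure (π n) := fun n => isProbabilityMeasure_of_mem_couplings (hπ n)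
  obtain ⟨ρ, hρ, hle⟩ := exists_coupling_of_seq hp hμ hν
    (c := sSup (corr '' couplings μ ν))
    (by simpa only [(hπ _).1] using UI2.const hμ)
    (fun f => by simpa only [(hπ _).1] using tendsto_const_nhds)
    (fun n => (hπ n).2)
    (fun δ hδ => by
      filter_upwards [hu.eventually (lt_mem_nhds (sub_lt_self _ hδ))] with n hn
      simpa only [hcorr] using hn.le)
  exact ⟨ρ, hρ, fun π' hπ' => (le_csSup hbdd ⟨π', hπ', rfl⟩).trans hle⟩

theorem lintegral_enorm_sub_sq {π : Measure (E d × E d)} (h₁ : π.fst ∈ P2 d) (h₂ : π.snd ∈ P2 d) :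
    ∫⁻ p, ‖p.2 - p.1‖ₑ ^ 2 ∂π =
      ENNReal.ofReal (∫ x, ‖x‖ ^ 2 ∂π.fst + ∫ x, ‖x‖ ^ 2 ∂π.snd - 2 * corr π) := by
  have i1 := integrable_fst_comp (integrable_norm_sq h₁)
  have i2 := integrable_snd_comp (integrable_norm_sq h₂)
  have i3 := (integrable_inner h₁ h₂).const_mul 2
  have i4 : Integrable (fun p : E d × E d => ‖p.1‖ ^ 2 + ‖p.2‖ ^ 2) π := i1.add i2
  rw [← integral_fst_comp (integrable_norm_sq h₁), ← integral_snd_comp (integrable_norm_sq h₂),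
    ← integral_add i1 i2, corr, ← integral_const_mul, ← integral_sub i4 i3]
  have hpt : ∀ p : E d × E d,
      ‖p.1‖ ^ 2 + ‖p.2‖ ^ 2 - 2 * inner ℝ p.1 p.2 = ‖p.2 - p.1‖ ^ 2 := fun p => by
    rw [norm_sub_sq_real, real_inner_comm]; ring
  have i5 : Integrable (fun p : E d × E d => ‖p.1‖ ^ 2 + ‖p.2‖ ^ 2 - 2 * inner ℝ p.1 p.2) π :=
    i4.sub i3
  rw [ofReal_integral_eq_lintegral_ofReal i5
    (Eventually.of_forall fun p => by simp [hpt])]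
  refine lintegral_congr fun p => ?_
  rw [hpt, ENNReal.ofReal_pow (norm_nonneg _), ofReal_norm]

theorem W2sq_toReal {μ ν : Measure (E d)} (hμ : μ ∈ P2 d) (hν : ν ∈ P2 d)
    {π : Measure (E d × E d)} (hπ : π ∈ couplings μ ν)
    (hmax : ∀ π' ∈ couplings μ ν, corr π' ≤ corr π) :
    (W2sq μ ν).toReal = ∫ x, ‖x‖ ^ 2 ∂μ + ∫ x, ‖x‖ ^ 2 ∂ν - 2 * corr π := by
  have hval : ∀ π' ∈ couplings μ ν, ∫⁻ p, ‖p.2 - p.1‖ₑ ^ 2 ∂π' =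
      ENNReal.ofReal (∫ x, ‖x‖ ^ 2 ∂μ + ∫ x, ‖x‖ ^ 2 ∂ν - 2 * corr π') := by
    rintro π' ⟨rfl, rfl⟩
    exact lintegral_enorm_sub_sq hμ hν
  have hW : W2sq μ ν = ENNReal.ofReal (∫ x, ‖x‖ ^ 2 ∂μ + ∫ x, ‖x‖ ^ 2 ∂ν - 2 * corr π) := by
    refine le_antisymm ((iInf₂_le π hπ).trans_eq (hval π hπ)) (le_iInf₂ fun π' hπ' => ?_)
    rw [hval π' hπ']
    exact ENNReal.ofReal_le_ofReal (by linarith [hmax π' hπ'])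
  rw [hW, ENNReal.toReal_ofReal]
  obtain ⟨rfl, rfl⟩ := hπ
  have i1 := integrable_fst_comp (integrable_norm_sq hμ)
  have i2 := integrable_snd_comp (integrable_norm_sq hν)
  rw [← integral_fst_comp (integrable_norm_sq hμ), ← integral_snd_comp (integrable_norm_sq hν),
    ← integral_add i1 i2, corr, ← integral_const_mul,
    ← integral_sub (f := fun p : E d × E d => ‖p.1‖ ^ 2 + ‖p.2‖ ^ 2) (i1.add i2) ((integrable_inner hμ hν).const_mul 2)]
  refine integral_nonneg fun p => ?_
  have := norm_sub_sq_real p.1 p.2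
  simp only [Pi.zero_apply]
  nlinarith [sq_nonneg ‖p.1 - p.2‖]

/-! ### Monotonicity of the maximal correlation, finitely supported first marginal. -/

/-- A measurable selection of a maximizer over a finite set. -/
theorem exists_measurable_argmax {F : Finset (E d)} (hF : F.Nonempty) {g : E d × E d → ℝ}
    (hg : Measurable g) :
    ∃ A : E d → E d, Measurable A ∧ ∀ y, A y ∈ F ∧ ∀ a ∈ F, g (a, y) ≤ g (A y, y) := by
  classical
  induction hF using Finset.Nonempty.cons_induction with
  | singleton a => exact ⟨fun _ => a, measurable_const, by simp⟩
  | cons a s ha hs ih =>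
    obtain ⟨A, hA, hmax⟩ := ih
    refine ⟨fun y => if g (A y, y) ≤ g (a, y) then a else A y,
      Measurable.ite (measurableSet_le (by fun_prop) (by fun_prop)) measurable_const hA,
      fun y => ?_⟩
    simp only [Finset.mem_cons, forall_eq_or_imp]
    split_ifs with h
    · exact ⟨Or.inl rfl, le_rfl, fun b hb => ((hmax y).2 b hb).trans h⟩
    · exact ⟨Or.inr (hmax y).1, (not_le.1 h).le, (hmax y).2⟩

section FiniteSupport

variable {F : Finset (E d)}

open Classical in
/-- Indicators of the points of a finite set in the first variable, and the inner product. -/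
noncomputable def obs (F : Finset (E d)) (p : E d × E d) : (F → ℝ) × ℝ :=
  (fun a => if p.1 = a then 1 else 0, inner ℝ p.1 p.2)

theorem measurable_obs (F : Finset (E d)) : Measurable (obs F) := by
  refine Measurable.prodMk (measurable_pi_lambda _ fun a => ?_) (by fun_prop)
  exact Measurable.ite (measurable_fst (measurableSet_singleton _)) measurable_const
    measurable_const

theorem mem_P2_of_ae_mem {ρ : Measure (E d)} [IsProbabilityMeasure ρ]
    (h : ∀ᵐ x ∂ρ, x ∈ F) : ρ ∈ P2 d := by
  refine ⟨inferInstance, ?_⟩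
  calc ∫⁻ x, ‖x‖ₑ ^ 2 ∂ρ ≤ ∫⁻ _, ∑ a ∈ F, ‖a‖ₑ ^ 2 ∂ρ := by
        refine lintegral_mono_ae (h.mono fun x hx => ?_)
        exact Finset.single_le_sum (f := fun a : E d => ‖a‖ₑ ^ 2) (fun _ _ => zero_le) hx
    _ < ∞ := by
        simp only [lintegral_const, measure_univ, mul_one]
        exact ENNReal.sum_lt_top.2 fun a _ => ENNReal.pow_lt_top enorm_lt_top

/-- Couplings with second marginal `ν` and first marginal carried by a finite set. -/
def finCouplings (F : Finset (E d)) (ν : Measure (E d)) : Set (Measure (E d × E d)) :=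
  {π | IsProbabilityMeasure π ∧ π.snd = ν ∧ ∀ᵐ x ∂π.fst, x ∈ F}

theorem finCouplings.fst_mem_P2 {ν : Measure (E d)} {π : Measure (E d × E d)}
    (h : π ∈ finCouplings F ν) : π.fst ∈ P2 d := by
  have := h.1
  exact mem_P2_of_ae_mem h.2.2

theorem finCouplings.ae_fst_mem {ν : Measure (E d)} {π : Measure (E d × E d)}
    (h : π ∈ finCouplings F ν) : ∀ᵐ p ∂π, p.1 ∈ F :=
  ae_of_ae_map measurable_fst.aemeasurable h.2.2

theorem integrable_obs {ν : Measure (E d)} (hν : ν ∈ P2 d) {π : Measure (E d × E d)}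
    (h : π ∈ finCouplings F ν) : Integrable (obs F) π := by
  have := h.1
  refine Integrable.prodMk ?_ (integrable_inner (finCouplings.fst_mem_P2 h) (h.2.1 ▸ hν))
  refine Integrable.of_eval fun a => ?_
  refine (integrable_const (1 : ℝ)).mono'
    ((measurable_pi_apply a).comp (measurable_obs F).fst).aestronglyMeasurable
    (Eventually.of_forall fun p => ?_)
  change ‖(obs F p).1 a‖ ≤ 1
  simp only [obs]
  split_ifs <;> simp

theorem convex_obs_image {ν : Measure (E d)} (hν : ν ∈ P2 d) :
    Convex ℝ ((fun π => ∫ p, obs F p ∂π) '' finCouplings F ν) := by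
  rintro _ ⟨π, hπ, rfl⟩ _ ⟨π', hπ', rfl⟩ a b ha hb hab
  have hp := hπ.1
  have hp' := hπ'.1
  have hab' : ENNReal.ofReal a + ENNReal.ofReal b = 1 := by
    rw [← ENNReal.ofReal_add ha hb, hab, ENNReal.ofReal_one]
  refine ⟨ENNReal.ofReal a • π + ENNReal.ofReal b • π', ⟨⟨by simp [hab']⟩, ?_, ?_⟩, ?_⟩
  · rw [Measure.snd_add, Measure.snd, Measure.snd, Measure.map_smul, Measure.map_smul]
    change _ • π.snd + _ • π'.snd = ν
    rw [hπ.2.1, hπ'.2.1, ← add_smul, hab', one_smul]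
  · rw [Measure.fst_add, Measure.fst, Measure.fst, Measure.map_smul, Measure.map_smul]
    rw [ae_add_measure_iff]
    exact ⟨Measure.ae_smul_measure hπ.2.2 _, Measure.ae_smul_measure hπ'.2.2 _⟩
  · beta_reduce
    rw [integral_add_measure ((integrable_obs hν hπ).smul_measure ENNReal.ofReal_ne_top)
      ((integrable_obs hν hπ').smul_measure ENNReal.ofReal_ne_top), integral_smul_measure,
      integral_smul_measure, ENNReal.toReal_ofReal ha, ENNReal.toReal_ofReal hb]

/-- Otherwise Hahn–Banach gives a functional `f` separating strictly. The function `G y = max_{a ∈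
F} f (obs F (a, y))` is convex, and its `η`-integral bounds `f` at the given vector. Its
`ν`-integral is at least as large and is attained by the coupling `(A y, y)`, which contradicts the
separation. -/
theorem integral_obs_mem_closure {η ν : Measure (E d)} (hη : η ∈ P2 d) (hν : ν ∈ P2 d)
    (h : PosCx η ν) {π : Measure (E d × E d)} (hπ : π ∈ finCouplings F η) :
    ∫ p, obs F p ∂π ∈ closure ((fun π => ∫ p, obs F p ∂π) '' finCouplings F ν) := by
  have hp := hπ.1
  have hF : F.Nonempty := by
    obtain ⟨p, hp⟩ := (finCouplings.ae_fst_mem hπ).exists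
    exact ⟨_, hp⟩
  by_contra hcon
  obtain ⟨f, u, hlt, hgt⟩ := geometric_hahn_banach_closed_point
    (convex_obs_image hν).closure isClosed_closure hcon
  have hg : Measurable fun p => f (obs F p) := f.measurable.comp (measurable_obs F)
  obtain ⟨A, hA, hmax⟩ := exists_measurable_argmax hF hg
  have hcoup : ∀ {ρ : Measure (E d)}, ρ ∈ P2 d →
      ρ.map (fun y => (A y, y)) ∈ finCouplings F ρ := by
    intro ρ hρ
    have := hρ.1
    have hm : Measurable fun y => (A y, y) := hA.prodMk measurable_id
    refine ⟨Measure.isProbabilityMeasure_map hm.aemeasurable, ?_, ?_⟩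
    · rw [Measure.snd_map_prodMk hA, Measure.map_id']
    · rw [Measure.fst_map_prodMk measurable_id']
      refine (ae_map_iff hA.aemeasurable F.measurableSet).2 ?_
      exact Eventually.of_forall fun y => (hmax y).1
  set G : E d → ℝ := fun y => f (obs F (A y, y)) with hG
  have hGint : ∀ {ρ : Measure (E d)}, ρ ∈ P2 d → Integrable G ρ := fun hρ =>
    (f.integrable_comp (integrable_obs hρ (hcoup hρ))).comp_measurable (hA.prodMk measurable_id)
  -- For fixed `a` the indicators do not depend on the second variable and the inner product is
  -- linear in it; `s + t = 1` is what handles the constant indicator part.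
  have haff : ∀ a x y : E d, ∀ s t : ℝ, s + t = 1 →
      f (obs F (a, s • x + t • y)) = s * f (obs F (a, x)) + t * f (obs F (a, y)) := by
    intro a x y s t hst
    rw [← smul_eq_mul, ← smul_eq_mul, ← map_smul, ← map_smul, ← map_add]
    congr 1
    ext b
    · simp only [obs, Prod.smul_mk, Prod.mk_add_mk, Pi.add_apply, Pi.smul_apply, smul_eq_mul]
      rw [← add_mul, hst, one_mul]
    · simp [obs, inner_add_right, real_inner_smul_right]
  have hGconv : ConvexOn ℝ univ G := by
    refine ⟨convex_univ, fun x _ y _ s t hs ht hst => ?_⟩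
    simp only [hG, smul_eq_mul]
    rw [haff _ _ _ _ _ hst]
    exact add_le_add (mul_le_mul_of_nonneg_left ((hmax x).2 _ (hmax _).1) hs)
      (mul_le_mul_of_nonneg_left ((hmax y).2 _ (hmax _).1) ht)
  have hsnd : Integrable G π.snd := hπ.2.1 ▸ hGint hη
  have h1 : f (∫ p, obs F p ∂π) ≤ ∫ y, G y ∂η := by
    rw [← f.integral_comp_comm (integrable_obs hη hπ), ← hπ.2.1, ← integral_snd_comp hsnd]
    refine integral_mono_ae (f.integrable_comp (integrable_obs hη hπ)) (integrable_snd_comp hsnd) ?_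
    filter_upwards [finCouplings.ae_fst_mem hπ] with p hp using (hmax p.2).2 p.1 hp
  have h2 := h.integral_le_of_integrable hη hν hGconv (hGint hη) (hGint hν)
  have h3 : ∫ y, G y ∂ν = f (∫ p, obs F p ∂(ν.map fun y => (A y, y))) := by
    rw [← f.integral_comp_comm (integrable_obs hν (hcoup hν)),
      integral_map (hA.prodMk measurable_id').aemeasurable hg.aestronglyMeasurable]
  have h4 := hlt _ (subset_closure ⟨_, hcoup hν, rfl⟩)
  simp only at h4
  linarith

/-- The indicator coordinates of `obs` are the masses of the first marginal, so convergence of these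
finitely many numbers gives its weak convergence. -/
theorem integral_fst_eq_sum {ν : Measure (E d)} (hν : ν ∈ P2 d) {π : Measure (E d × E d)}
    (hπ : π ∈ finCouplings F ν) {h : E d → ℝ} (hh : Measurable h) :
    ∫ x, h x ∂π.fst = ∑ a : F, h a * (∫ p, obs F p ∂π).1 a := by
  have hi := integrable_obs hν hπ
  have hia : ∀ a : F, Integrable (fun p => (obs F p).1 a) π := fun a => hi.fst.eval a
  have h1 : ∀ a : F, (∫ p, obs F p ∂π).1 a = ∫ p, (obs F p).1 a ∂π := fun a => by
    rw [fst_integral hi, eval_integral fun a => hia a]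
  simp_rw [h1, ← integral_const_mul]
  rw [← integral_finsetSum _ fun a _ => (hia a).const_mul _, Measure.fst,
    integral_map measurable_fst.aemeasurable hh.aestronglyMeasurable]
  refine integral_congr_ae ?_
  filter_upwards [finCouplings.ae_fst_mem hπ] with p hp
  rw [Finset.sum_eq_single (⟨p.1, hp⟩ : F)]
  · simp [obs]
  · intro b _ hb
    have : p.1 ≠ b := fun h => hb (Subtype.ext h.symm)
    simp [obs, this]
  · simp

/-- Monotonicity of the maximal correlation when the first marginal has finite support. -/
theorem exists_coupling_corr_le_of_finite {η ν : Measure (E d)} (hη : η ∈ P2 d) (hν : ν ∈ P2 d)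
    (h : PosCx η ν) {π : Measure (E d × E d)} (hπ : π ∈ finCouplings F η) :
    ∃ ρ ∈ couplings π.fst ν, corr π ≤ corr ρ := by
  have hp := hπ.1
  obtain ⟨w, hw, hlim⟩ := mem_closure_iff_seq_limit.1 (integral_obs_mem_closure hη hν h hπ)
  choose s hs hsw using hw
  have hcorr : ∀ {ρ ξ : Measure _}, ξ ∈ P2 d → ρ ∈ finCouplings F ξ →
      corr ρ = (∫ p, obs F p ∂ρ).2 := fun hξ hρ => by
    rw [snd_integral (integrable_obs hξ hρ)]; rfl
  refine exists_coupling_of_seq (fun n => (hs n).1)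
    (finCouplings.fst_mem_P2 hπ) hν ?_ (fun f => ?_) (fun n => (hs n).2.1) fun δ hδ => ?_
  · intro ε _
    -- A radius dominating every point of `F`, so that the excess vanishes almost everywhere.
    refine ⟨∑ a ∈ F, ‖a‖, by positivity, fun n => ?_⟩
    rw [lintegral_eq_zero_iff' (continuous_excess _).measurable.ennreal_ofReal.aemeasurable |>.2]
    · exact zero_le
    · filter_upwards [(hs n).2.2] with x hx
      have : ‖x‖ ≤ ∑ a ∈ F, ‖a‖ :=
        Finset.single_le_sum (f := fun a : E d => ‖a‖) (fun _ _ => norm_nonneg _) hx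
      simp [excess, max_eq_right (sub_nonpos.2 this)]
  · have hf : Measurable f := f.continuous.measurable
    simp_rw [integral_fst_eq_sum hη hπ hf, integral_fst_eq_sum hν (hs _) hf]
    refine tendsto_finsetSum _ fun a _ => tendsto_const_nhds.mul ?_
    have := (((continuous_apply a).comp continuous_fst).tendsto _).comp hlim
    refine this.congr fun n => ?_
    simp [← hsw n]
  · have h2 := (continuous_snd.tendsto _).comp hlim
    rw [← hcorr hη hπ] at h2
    filter_upwards [h2.eventually (lt_mem_nhds (sub_lt_self _ hδ))] with n hn
    refine hn.le.trans_eq ?_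
    simp only [Function.comp_apply]
    rw [hcorr hν (hs n), ← hsw n]

end FiniteSupport

/-! ### Monotonicity of the maximal correlation, general first marginal. -/

/-- Monotonicity of the maximal correlation for the convex order. -/
theorem PosCx.exists_coupling_corr_le {μ η ν : Measure (E d)} (h : PosCx η ν) (hμ : μ ∈ P2 d)
    (hη : η ∈ P2 d) (hν : ν ∈ P2 d) {π : Measure (E d × E d)} (hπ : π ∈ couplings μ η) :
    ∃ ρ ∈ couplings μ ν, corr π ≤ corr ρ := by
  have := hμ.1
  have hp := isProbabilityMeasure_of_mem_couplings hπ
  obtain ⟨hπ₁, hπ₂⟩ := hπ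
  let q : ℕ → SimpleFunc (E d) (E d) :=
    SimpleFunc.approxOn id measurable_id univ 0 (mem_univ _)
  have hq : ∀ n x, ‖q n x‖ ≤ 2 * ‖x‖ := fun n x => by
    rw [two_mul]; exact SimpleFunc.norm_approxOn_zero_le measurable_id (mem_univ _) x n
  have hqlim : ∀ x, Tendsto (fun n => q n x) atTop (𝓝 x) := fun x =>
    SimpleFunc.tendsto_approxOn measurable_id (mem_univ _) (by simp)
  have hqm : ∀ n, Measurable (q n) := fun n => (q n).measurable
  let T : ℕ → E d × E d → E d × E d := fun n p => (q n p.1, p.2)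
  have hT : ∀ n, Measurable (T n) := fun n => by
    have := hqm n
    fun_prop
  have hfst : ∀ n, (π.map (T n)).fst = μ.map (q n) := fun n => by
    rw [Measure.fst, Measure.map_map measurable_fst (hT n), ← hπ₁, Measure.fst,
      Measure.map_map (hqm n) measurable_fst]
    rfl
  have hmem : ∀ n, π.map (T n) ∈ finCouplings (q n).range η := fun n => by
    refine ⟨Measure.isProbabilityMeasure_map (hT n).aemeasurable, ?_, ?_⟩
    · rw [Measure.snd, Measure.map_map measurable_snd (hT n), ← hπ₂]
      rfl
    · rw [hfst]
      refine (ae_map_iff (hqm n).aemeasurable (q n).range.measurableSet).2 ?_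
      exact Eventually.of_forall fun x => SimpleFunc.mem_range_self _ _
  -- The first variable has been discretized by `q n`, so the finite case applies for each `n`; the
  -- couplings obtained are then passed to the limit.
  choose s hs hle using fun n => exists_coupling_corr_le_of_finite hη hν h (hmem n)
  have hs' : ∀ n, s n ∈ couplings (μ.map (q n)) ν := fun n => hfst n ▸ hs n
  have hmp : ∀ n, IsProbabilityMeasure (μ.map (q n)) := fun n =>
    Measure.isProbabilityMeasure_map (hqm n).aemeasurable
  have hps : ∀ n, IsProbabilityMeasure (s n) := fun n =>
    isProbabilityMeasure_of_mem_couplings (hs' n)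
  have hlim : Tendsto (fun n => corr (π.map (T n))) atTop (𝓝 (corr π)) := by
    have : ∀ n, corr (π.map (T n)) = ∫ p, inner ℝ (q n p.1) p.2 ∂π := fun n => by
      rw [corr, integral_map (hT n).aemeasurable (by fun_prop)]
    simp_rw [this, corr]
    refine tendsto_integral_of_dominated_convergence (fun p => ‖p.1‖ ^ 2 + ‖p.2‖ ^ 2)
      (fun n => ?_) ((integrable_fst_comp (integrable_norm_sq (hπ₁ ▸ hμ))).add
      (integrable_snd_comp (integrable_norm_sq (hπ₂ ▸ hη)))) (fun n => Eventually.of_forall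
      fun p => ?_) (Eventually.of_forall fun p => (hqlim p.1).inner tendsto_const_nhds)
    · have := hqm n
      exact Measurable.aestronglyMeasurable (by fun_prop)
    · refine (norm_inner_le_norm _ _).trans ?_
      have := mul_le_mul_of_nonneg_right (hq n p.1) (norm_nonneg p.2)
      nlinarith [sq_nonneg (‖p.1‖ - ‖p.2‖)]
  refine exists_coupling_of_seq hps hμ hν ?_ (fun f => ?_)
    (fun n => (hs n).2) fun δ hδ => ?_
  · intro ε hε
    -- Since `‖q n x‖ ≤ 2 * ‖x‖`, doubling the radius gives `excess (2 * R) (q n x) ≤ 4 * excess R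
    -- x`; hence the target `ε / 4`.
    obtain ⟨R, hR, hRle⟩ := exists_excess_le hμ (show (0 : ℝ) < ε / 4 by positivity)
    refine ⟨2 * R, by positivity, fun n => ?_⟩
    change ∫⁻ x, ENNReal.ofReal (excess (2 * R) x) ∂(s n).fst ≤ _
    rw [(hs' n).1, lintegral_map (continuous_excess _).measurable.ennreal_ofReal (hqm n)]
    calc ∫⁻ x, ENNReal.ofReal (excess (2 * R) (q n x)) ∂μ
        ≤ ∫⁻ x, ENNReal.ofReal 4 * ENNReal.ofReal (excess R x) ∂μ := by
          refine lintegral_mono fun x => ?_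
          rw [← ENNReal.ofReal_mul (by norm_num)]
          refine ENNReal.ofReal_le_ofReal ?_
          have : max (‖q n x‖ - 2 * R) 0 ≤ 2 * max (‖x‖ - R) 0 := by
            refine max_le ?_ (by positivity)
            linarith [hq n x, le_max_left (‖x‖ - R) 0]
          calc excess (2 * R) (q n x) ≤ (2 * max (‖x‖ - R) 0) ^ 2 := by
                unfold excess; gcongr
            _ = 4 * excess R x := by unfold excess; ring
      _ = ENNReal.ofReal 4 * ∫⁻ x, ENNReal.ofReal (excess R x) ∂μ :=
          lintegral_const_mul _ (continuous_excess R).measurable.ennreal_ofReal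
      _ ≤ ENNReal.ofReal 4 * ENNReal.ofReal (ε / 4) := by gcongr
      _ = ENNReal.ofReal ε := by
          rw [← ENNReal.ofReal_mul (by norm_num)]
          congr 1
          ring
  · have : ∀ n, ∫ x, f x ∂(s n).fst = ∫ x, f (q n x) ∂μ := fun n => by
      rw [(hs' n).1, integral_map (hqm n).aemeasurable f.continuous.aestronglyMeasurable]
    simp_rw [this]
    exact tendsto_integral_of_dominated_convergence (fun _ => ‖f‖)
      (fun n => (f.continuous.measurable.comp (hqm n)).aestronglyMeasurable) (integrable_const _)
      (fun n => Eventually.of_forall fun x => f.norm_coe_le_norm _)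
      (Eventually.of_forall fun x => (f.continuous.tendsto x).comp (hqlim x))
  · filter_upwards [hlim.eventually (lt_mem_nhds (sub_lt_self _ hδ))] with n hn
    exact hn.le.trans (hle n)

/-! ### The set `I μ ν` through correlations, and existence of minimizers. -/

/-- The second moments cancel, leaving equality of the two maximal correlations. One inequality is
automatic by monotonicity, so a coupling of `μ` and `η` that beats all couplings of `μ` and `ν`
suffices. -/
theorem mem_I_iff {μ ν η : Measure (E d)} (hμ : μ ∈ P2 d) (hν : ν ∈ P2 d) :
    η ∈ I μ ν ↔ IsProbabilityMeasure η ∧ PosCx η ν ∧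
      ∃ π ∈ couplings μ η, ∀ π' ∈ couplings μ ν, corr π' ≤ corr π := by
  obtain ⟨πν, hπν, hmaxν⟩ := exists_max_corr hμ hν
  constructor
  · rintro ⟨hη, hcx, heq⟩
    obtain ⟨πη, hπη, hmaxη⟩ := exists_max_corr hμ hη
    rw [W2sq_toReal hμ hν hπν hmaxν, W2sq_toReal hμ hη hπη hmaxη] at heq
    exact ⟨hη.1, hcx.posCx, πη, hπη, fun π' hπ' => (hmaxν π' hπ').trans (by linarith)⟩
  · rintro ⟨hp, hcx, π, hπ, hle⟩
    have hη := hcx.mem_P2 hp hν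
    obtain ⟨πη, hπη, hmaxη⟩ := exists_max_corr hμ hη
    obtain ⟨ρ, hρ, hπρ⟩ := hcx.exists_coupling_corr_le hμ hη hν hπη
    refine ⟨hη, hcx.cxLE hη hν, ?_⟩
    rw [W2sq_toReal hμ hν hπν hmaxν, W2sq_toReal hμ hη hπη hmaxη]
    linarith [hle πν hπν, hmaxη π hπ, hmaxν ρ hρ]

theorem self_mem_I {μ ν : Measure (E d)} (hμ : μ ∈ P2 d) (hν : ν ∈ P2 d) : ν ∈ I μ ν :=
  (mem_I_iff hμ hν).2 ⟨hν.1, PosCx.refl ν, exists_max_corr hμ hν⟩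

theorem posCx_of_mem_I {μ ν η : Measure (E d)} (h : η ∈ I μ ν) : PosCx η ν := h.2.1.posCx

/-- Existence of minimizers of the integral of a nonnegative convex function. -/
theorem exists_minimizer {μ ν : Measure (E d)} (hμ : μ ∈ P2 d) (hν : ν ∈ P2 d) {ψ : E d → ℝ}
    (hψ : ConvexOn ℝ univ ψ) (h0 : ∀ x, 0 ≤ ψ x) :
    ∃ η ∈ I μ ν, ∀ η' ∈ I μ ν,
      ∫⁻ x, ENNReal.ofReal (ψ x) ∂η ≤ ∫⁻ x, ENNReal.ofReal (ψ x) ∂η' := by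
  set S : Set ℝ≥0∞ := (fun η => ∫⁻ x, ENNReal.ofReal (ψ x) ∂η) '' I μ ν with hS
  obtain ⟨u, -, hu, hmem⟩ := exists_seq_tendsto_sInf (S := S) ⟨_, ν, self_mem_I hμ hν, rfl⟩
    (OrderBot.bddBelow S)
  choose η hη hηu using hmem
  have hch := fun n => (mem_I_iff hμ hν).1 (hη n)
  choose hp hcx π hπ hle using hch
  have := hμ.1
  have hpπ : ∀ n, IsProbabilityMeasure (π n) := fun n => isProbabilityMeasure_of_mem_couplings (hπ n)
  obtain ⟨πν, hπν, hmaxν⟩ := exists_max_corr hμ hν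
  let t : ℕ → ProbabilityMeasure (E d × E d) := fun n => ⟨π n, hpπ n⟩
  have h₁ : UI2 fun n => (π n).fst := by simpa only [(hπ _).1] using UI2.const hμ
  have h₂ : UI2 fun n => (π n).snd := by simpa only [(hπ _).2] using UI2.of_posCx hν hcx
  -- The limit is taken on couplings rather than on their second marginals, so that the lower bound
  -- on the correlation survives.
  obtain ⟨ρ, k, hk, hρ, hcorr⟩ := exists_subseq_tendsto t h₁ h₂
  refine ⟨(ρ : Measure (E d × E d)).snd, (mem_I_iff hμ hν).2 ⟨inferInstance, ?_, ρ, ⟨?_, rfl⟩,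
    fun π' hπ' => (hmaxν π' hπ').trans (hcorr _ fun δ hδ => Eventually.of_forall fun n => ?_)⟩,
    fun η' hη' => ?_⟩
  · refine posCx_of_tendsto (tendsto_psnd hρ) fun n => ?_
    change PosCx (π (k n)).snd ν
    rw [(hπ _).2]
    exact hcx _
  · exact eq_of_tendsto_const (tendsto_pfst hρ) fun n => (hπ (k n)).1
  · have : corr πν ≤ corr (t n : Measure (E d × E d)) := hle n πν hπν
    linarith
  · have hinf : ∫⁻ x, ENNReal.ofReal (ψ x) ∂(ρ : Measure (E d × E d)).snd ≤ sInf S := by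
      refine le_of_forall_gt_imp_ge_of_dense fun C hC => ?_
      refine lintegral_le_of_tendsto (tendsto_psnd hρ) (continuous_of_convexOn hψ) h0 ?_
      filter_upwards [(hu.comp hk.tendsto_atTop).eventually (gt_mem_nhds hC)] with n hn
      change ∫⁻ x, ENNReal.ofReal (ψ x) ∂(π (k n)).snd ≤ C
      rw [(hπ _).2]
      exact (hηu _).trans_le hn.le
    exact hinf.trans (sInf_le ⟨η', hη', rfl⟩)

/-! ### Gluing, midpoints and uniqueness of minimizers. -/

open ProbabilityTheory in
/-- Gluing of two couplings along their common first marginal. -/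
theorem exists_gluing {μ η η' : Measure (E d)} [IsProbabilityMeasure μ]
    {π π' : Measure (E d × E d)} (hπ : π ∈ couplings μ η) (hπ' : π' ∈ couplings μ η') :
    ∃ γ : Measure (E d × E d × E d), IsProbabilityMeasure γ ∧
      γ.map (fun p => (p.1, p.2.1)) = π ∧ γ.map (fun p => (p.1, p.2.2)) = π' := by
  have := isProbabilityMeasure_of_mem_couplings hπ
  have := isProbabilityMeasure_of_mem_couplings hπ'
  -- The second and third coordinates are taken conditionally independent given the first.
  refine ⟨μ ⊗ₘ (π.condKernel ×ₖ π'.condKernel), inferInstance, ?_, ?_⟩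
  · conv_rhs => rw [← π.disintegrate π.condKernel, hπ.1]
    ext s hs
    have hm : Measurable fun p : E d × E d × E d => (p.1, p.2.1) := by fun_prop
    rw [Measure.map_apply hm hs, Measure.compProd_apply (hm hs), Measure.compProd_apply hs]
    refine lintegral_congr fun x => ?_
    have : Prod.mk x ⁻¹' ((fun p : E d × E d × E d => (p.1, p.2.1)) ⁻¹' s) =
        (Prod.mk x ⁻¹' s) ×ˢ univ := by
      ext p; simp
    rw [this, Kernel.prod_apply, Measure.prod_prod, measure_univ, mul_one]
  · conv_rhs => rw [← π'.disintegrate π'.condKernel, hπ'.1]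
    ext s hs
    have hm : Measurable fun p : E d × E d × E d => (p.1, p.2.2) := by fun_prop
    rw [Measure.map_apply hm hs, Measure.compProd_apply (hm hs), Measure.compProd_apply hs]
    refine lintegral_congr fun x => ?_
    have : Prod.mk x ⁻¹' ((fun p : E d × E d × E d => (p.1, p.2.2)) ⁻¹' s) =
        univ ×ˢ (Prod.mk x ⁻¹' s) := by
      ext p; simp
    rw [this, Kernel.prod_apply, Measure.prod_prod, measure_univ, one_mul]

/-- Any two elements of `I μ ν` are the laws of two random variables such that the law of their
midpoint belongs to `I μ ν`. -/
theorem exists_midpoint_mem_I {μ ν η η' : Measure (E d)} (hμ : μ ∈ P2 d) (hν : ν ∈ P2 d)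
    (hη : η ∈ I μ ν) (hη' : η' ∈ I μ ν) :
    ∃ γ : Measure (E d × E d), γ.fst = η ∧ γ.snd = η' ∧
      γ.map (fun p => (1 / 2 : ℝ) • p.1 + (1 / 2 : ℝ) • p.2) ∈ I μ ν := by
  have := hμ.1
  obtain ⟨-, hcx, π, hπ, hle⟩ := (mem_I_iff hμ hν).1 hη
  obtain ⟨-, hcx', π', hπ', hle'⟩ := (mem_I_iff hμ hν).1 hη'
  obtain ⟨γ, hγ, h1, h2⟩ := exists_gluing hπ hπ'
  have hm1 : Measurable fun p : E d × E d × E d => (p.1, p.2.1) := by fun_prop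
  have hm2 : Measurable fun p : E d × E d × E d => (p.1, p.2.2) := by fun_prop
  have hmid : Measurable fun p : E d × E d => (1 / 2 : ℝ) • p.1 + (1 / 2 : ℝ) • p.2 := by
    fun_prop
  have hmid' : Measurable fun p : E d × E d × E d =>
      (p.1, (1 / 2 : ℝ) • p.2.1 + (1 / 2 : ℝ) • p.2.2) := by fun_prop
  have hfst : γ.snd.fst = η := by
    rw [← hπ.2, ← h1, Measure.fst, Measure.snd, Measure.snd, Measure.map_map measurable_fst
      measurable_snd, Measure.map_map measurable_snd hm1]
    rfl
  have hsnd : γ.snd.snd = η' := by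
    rw [← hπ'.2, ← h2, Measure.snd, Measure.snd, Measure.snd, Measure.map_map measurable_snd
      measurable_snd, Measure.map_map measurable_snd hm2]
    rfl
  refine ⟨γ.snd, hfst, hsnd, (mem_I_iff hμ hν).2 ⟨Measure.isProbabilityMeasure_map
    hmid.aemeasurable, fun φ hφ h0 => ?_, γ.map fun p =>
      (p.1, (1 / 2 : ℝ) • p.2.1 + (1 / 2 : ℝ) • p.2.2), ⟨?_, ?_⟩, fun ξ hξ => ?_⟩⟩
  · have hφm : Measurable fun x => ENNReal.ofReal (φ x) :=
      (continuous_of_convexOn hφ).measurable.ennreal_ofReal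
    rw [lintegral_map hφm hmid]
    calc ∫⁻ p, ENNReal.ofReal (φ ((1 / 2 : ℝ) • p.1 + (1 / 2 : ℝ) • p.2)) ∂γ.snd
        ≤ ∫⁻ p, (ENNReal.ofReal (1 / 2) * ENNReal.ofReal (φ p.1) +
            ENNReal.ofReal (1 / 2) * ENNReal.ofReal (φ p.2)) ∂γ.snd := by
          refine lintegral_mono fun p => ?_
          rw [← ENNReal.ofReal_mul (by norm_num), ← ENNReal.ofReal_mul (by norm_num),
            ← ENNReal.ofReal_add (mul_nonneg (by norm_num) (h0 _))
              (mul_nonneg (by norm_num) (h0 _))]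
          exact ENNReal.ofReal_le_ofReal (hφ.2 (mem_univ _) (mem_univ _) (by norm_num)
            (by norm_num) (by norm_num))
      _ = ENNReal.ofReal (1 / 2) * ∫⁻ x, ENNReal.ofReal (φ x) ∂η +
            ENNReal.ofReal (1 / 2) * ∫⁻ x, ENNReal.ofReal (φ x) ∂η' := by
          have m1 : Measurable fun p : E d × E d => ENNReal.ofReal (φ p.1) :=
            hφm.comp measurable_fst
          have m2 : Measurable fun p : E d × E d => ENNReal.ofReal (φ p.2) :=
            hφm.comp measurable_snd
          rw [lintegral_add_left (m1.const_mul _), lintegral_const_mul _ m1,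
            lintegral_const_mul _ m2, ← hfst, ← hsnd]
          exact congrArg₂ _ (congrArg _ (lintegral_map hφm measurable_fst).symm)
            (congrArg _ (lintegral_map hφm measurable_snd).symm)
      _ ≤ ENNReal.ofReal (1 / 2) * ∫⁻ x, ENNReal.ofReal (φ x) ∂ν +
            ENNReal.ofReal (1 / 2) * ∫⁻ x, ENNReal.ofReal (φ x) ∂ν := by
          exact add_le_add (mul_le_mul_right (hcx φ hφ h0) _) (mul_le_mul_right (hcx' φ hφ h0) _)
      _ = ∫⁻ x, ENNReal.ofReal (φ x) ∂ν := by
          rw [← add_mul, ← ENNReal.ofReal_add (by norm_num) (by norm_num)]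
          norm_num
  · rw [← hπ.1, ← h1, Measure.fst, Measure.fst, Measure.map_map measurable_fst hmid',
      Measure.map_map measurable_fst hm1]
    rfl
  · rw [Measure.snd, Measure.snd, Measure.map_map measurable_snd hmid',
      Measure.map_map hmid measurable_snd]
    rfl
  · have i1 : Integrable (fun p : E d × E d × E d => inner ℝ p.1 p.2.1) γ := by
      have : Integrable (fun p : E d × E d => inner ℝ p.1 p.2) (γ.map fun p => (p.1, p.2.1)) :=
        h1 ▸ integrable_inner (hπ.1 ▸ hμ) (hπ.2 ▸ hη.1)
      exact this.comp_measurable hm1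
    have i2 : Integrable (fun p : E d × E d × E d => inner ℝ p.1 p.2.2) γ := by
      have : Integrable (fun p : E d × E d => inner ℝ p.1 p.2) (γ.map fun p => (p.1, p.2.2)) :=
        h2 ▸ integrable_inner (hπ'.1 ▸ hμ) (hπ'.2 ▸ hη'.1)
      exact this.comp_measurable hm2
    have e1 : corr π = ∫ p, inner ℝ p.1 p.2.1 ∂γ := by
      rw [corr, ← h1, integral_map hm1.aemeasurable (by fun_prop)]
    have e2 : corr π' = ∫ p, inner ℝ p.1 p.2.2 ∂γ := by
      rw [corr, ← h2, integral_map hm2.aemeasurable (by fun_prop)]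
    -- The inner product is linear in its second argument, so the midpoint has the average of the
    -- two correlations, each of which dominates `corr ξ`.
    rw [corr, corr, integral_map hmid'.aemeasurable (by fun_prop)]
    simp only [inner_add_right, real_inner_smul_right]
    rw [integral_add (i1.const_mul _) (i2.const_mul _), integral_const_mul, integral_const_mul,
      ← e1, ← e2]
    have := hle ξ hξ
    have := hle' ξ hξ
    change corr ξ ≤ _
    linarith

/-- Uniqueness of the minimizer of the integral of a nonnegative strictly convex function. -/
theorem minimizer_unique {μ ν η η' : Measure (E d)} (hμ : μ ∈ P2 d) (hν : ν ∈ P2 d)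
    {ψ : E d → ℝ} (hψ : StrictConvexOn ℝ univ ψ) (h0 : ∀ x, 0 ≤ ψ x)
    (hfin : ∫⁻ x, ENNReal.ofReal (ψ x) ∂ν < ∞) (hη : η ∈ I μ ν) (hη' : η' ∈ I μ ν)
    (hmin : ∀ ξ ∈ I μ ν, ∫⁻ x, ENNReal.ofReal (ψ x) ∂η ≤ ∫⁻ x, ENNReal.ofReal (ψ x) ∂ξ)
    (hmin' : ∀ ξ ∈ I μ ν, ∫⁻ x, ENNReal.ofReal (ψ x) ∂η' ≤ ∫⁻ x, ENNReal.ofReal (ψ x) ∂ξ) :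
    η = η' := by
  obtain ⟨γ, rfl, rfl, hmem⟩ := exists_midpoint_mem_I hμ hν hη hη'
  have hc := continuous_of_convexOn hψ.convexOn
  have hint : ∀ {ξ : Measure (E d)}, ξ ∈ I μ ν → Integrable ψ ξ := fun {ξ} hξ => by
    refine ⟨hc.aestronglyMeasurable, ?_⟩
    rw [hasFiniteIntegral_iff_ofReal (Eventually.of_forall h0)]
    exact (posCx_of_mem_I hξ ψ hψ.convexOn h0).trans_lt hfin
  have hreal : ∀ {ξ ξ' : Measure (E d)}, ξ ∈ I μ ν → ξ' ∈ I μ ν →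
      ∫⁻ x, ENNReal.ofReal (ψ x) ∂ξ ≤ ∫⁻ x, ENNReal.ofReal (ψ x) ∂ξ' →
      ∫ x, ψ x ∂ξ ≤ ∫ x, ψ x ∂ξ' := fun {ξ ξ'} hξ hξ' hle => by
    rw [← ofReal_integral_eq_lintegral_ofReal (hint hξ) (Eventually.of_forall h0),
      ← ofReal_integral_eq_lintegral_ofReal (hint hξ') (Eventually.of_forall h0)] at hle
    exact (ENNReal.ofReal_le_ofReal_iff (integral_nonneg h0)).1 hle
  have hmid : Measurable fun p : E d × E d => (1 / 2 : ℝ) • p.1 + (1 / 2 : ℝ) • p.2 := by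
    fun_prop
  have i1 := integrable_fst_comp (hint hη)
  have i2 := integrable_snd_comp (hint hη')
  have i3 : Integrable (fun p : E d × E d => ψ ((1 / 2 : ℝ) • p.1 + (1 / 2 : ℝ) • p.2)) γ :=
    (hint hmem).comp_measurable hmid
  have i4 : Integrable (fun p : E d × E d => 1 / 2 * ψ p.1 + 1 / 2 * ψ p.2) γ :=
    (i1.const_mul _).add (i2.const_mul _)
  have l1 := hreal hη hmem (hmin _ hmem)
  have l2 := hreal hη' hmem (hmin' _ hmem)
  rw [integral_map hmid.aemeasurable hc.aestronglyMeasurable] at l1 l2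
  rw [← integral_fst_comp (hint hη)] at l1
  rw [← integral_snd_comp (hint hη')] at l2
  -- The convexity gap at the midpoint is nonnegative, while minimality of both marginals makes its
  -- integral nonpositive. It vanishes almost everywhere, and strictness forces the two coordinates
  -- to agree there.
  have hD0 : ∀ p : E d × E d, 0 ≤ 1 / 2 * ψ p.1 + 1 / 2 * ψ p.2 -
      ψ ((1 / 2 : ℝ) • p.1 + (1 / 2 : ℝ) • p.2) := fun p =>
    sub_nonneg.2 (hψ.convexOn.2 (mem_univ _) (mem_univ _) (by norm_num) (by norm_num)
      (by norm_num))
  have hD : ∫ p, (1 / 2 * ψ p.1 + 1 / 2 * ψ p.2 -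
      ψ ((1 / 2 : ℝ) • p.1 + (1 / 2 : ℝ) • p.2)) ∂γ = 0 := by
    refine le_antisymm ?_ (integral_nonneg hD0)
    rw [integral_sub i4 i3, integral_add (i1.const_mul _) (i2.const_mul _), integral_const_mul,
      integral_const_mul]
    linarith
  have hae := (integral_eq_zero_iff_of_nonneg hD0 (i4.sub i3)).1 hD
  refine Measure.map_congr ?_
  filter_upwards [hae] with p hp
  by_contra hne
  have := hψ.2 (mem_univ p.1) (mem_univ p.2) hne (show (0 : ℝ) < 1 / 2 by norm_num)
    (show (0 : ℝ) < 1 / 2 by norm_num) (by norm_num)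
  simp only [smul_eq_mul, Pi.zero_apply] at this hp
  linarith

/-! ### The measures `η_φ` and intervals of the convex order. -/

/-- All elements of `I μ ν` give an affine function the same integral as `ν` does. Subtracting an
affine minorant therefore preserves minimizers and reduces to a nonnegative integrand. -/
theorem exists_Iphi_eq_singleton {μ ν : Measure (E d)} (hμ : μ ∈ P2 d) (hν : ν ∈ P2 d)
    {φ : E d → ℝ} (hφ : Admissible ν φ) : ∃ η, Iphi μ ν φ = {η} := by
  obtain ⟨L, c, hL⟩ := exists_affine_le hφ.1.convexOn
  have hψ : StrictConvexOn ℝ univ fun x => φ x - (L x + c) :=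
    hφ.1.sub_concaveOn ((L.toLinearMap.concaveOn convex_univ).add_const c)
  have h0 : ∀ x, 0 ≤ φ x - (L x + c) := fun x => sub_nonneg.2 (hL x)
  have hfin : ∫⁻ x, ENNReal.ofReal (φ x - (L x + c)) ∂ν < ∞ := by
    have hi := (integrable_affine hν L c).neg
    refine lt_of_le_of_lt (lintegral_mono fun x => ?_)
      (b := ∫⁻ x, (ENNReal.ofReal (φ x) + ENNReal.ofReal (-(L x + c))) ∂ν) ?_
    · rw [sub_eq_add_neg]
      exact ENNReal.ofReal_add_le
    · rw [lintegral_add_left (continuous_of_convexOn hφ.1.convexOn).measurable.ennreal_ofReal]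
      exact ENNReal.add_lt_top.2 ⟨hφ.2, hi.lintegral_lt_top⟩
  have hle : ∀ {ξ ξ' : Measure (E d)}, ξ ∈ I μ ν → ξ' ∈ I μ ν →
      (extIntegral ξ φ ≤ extIntegral ξ' φ ↔ ∫⁻ x, ENNReal.ofReal (φ x - (L x + c)) ∂ξ ≤
        ∫⁻ x, ENNReal.ofReal (φ x - (L x + c)) ∂ξ') := fun {ξ ξ'} hξ hξ' => by
    rw [extIntegral_eq_add hξ.1 hφ.1.convexOn hL, extIntegral_eq_add hξ'.1 hφ.1.convexOn hL,
      (posCx_of_mem_I hξ).integral_affine_eq hξ.1 hν,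
      (posCx_of_mem_I hξ').integral_affine_eq hξ'.1 hν,
      (EReal.addLECancellable_coe _).add_le_add_iff_right, EReal.coe_ennreal_le_coe_ennreal_iff]
  obtain ⟨η, hη, hmin⟩ := exists_minimizer hμ hν hψ.convexOn h0
  refine ⟨η, Subset.antisymm (fun η' hη' => ?_)
    (singleton_subset_iff.2 ⟨hη, fun ξ hξ => (hle hη hξ).2 (hmin ξ hξ)⟩)⟩
  exact minimizer_unique hμ hν hψ h0 hfin hη'.1 hη (fun ξ hξ => (hle hη'.1 hξ).1 (hη'.2 ξ hξ)) hmin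

theorem minimizers_singleton (η : Measure (E d)) (φ : E d → ℝ) : minimizers {η} φ = {η} := by
  ext ξ
  simp only [minimizers, mem_ofPred_eq, mem_singleton_iff, forall_eq]
  exact ⟨fun h => h.1, fun h => ⟨h, by rw [h]⟩⟩

theorem isEtaPhi_iff {μ ν η : Measure (E d)} {φ : E d → ℝ} (h : Iphi μ ν φ = {η})
    (ξ : Measure (E d)) : IsEtaPhi μ ν φ ξ ↔ ξ = η := by
  rw [IsEtaPhi, h, minimizers_singleton, mem_singleton_iff]

theorem integralMakesSense_of_convexOn {η : Measure (E d)} (hη : η ∈ P2 d) {φ : E d → ℝ}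
    (hφ : ConvexOn ℝ univ φ) : IntegralMakesSense η φ := by
  obtain ⟨L, c, hL⟩ := exists_affine_le hφ
  refine Or.inr (lt_of_le_of_lt (lintegral_mono fun x => ENNReal.ofReal_le_ofReal ?_)
    (integrable_affine hη L c).neg.lintegral_lt_top)
  simpa using hL x

theorem admissible_norm_sq {ν : Measure (E d)} (hν : ν ∈ P2 d) :
    Admissible ν fun x => ‖x‖ ^ 2 :=
  ⟨strictConvexOn_norm_sq, by rw [← lintegral_norm_sq]; exact hν.2⟩

theorem CxLE.refl (η : Measure (E d)) : CxLE η η := fun _ _ _ _ => le_rfl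

/-- As `ν` belongs to `I μ ν`, it lies above `η₀`; hence `η₀` is in its own interval, and it is
below every other element. -/
theorem mem_Iphi_of_I_eq_cxInterval {μ ν η₀ : Measure (E d)} (hμ : μ ∈ P2 d) (hν : ν ∈ P2 d)
    (hη₀ : η₀ ∈ P2 d) (h : I μ ν = cxInterval η₀ ν) {φ : E d → ℝ} (hφ : Admissible ν φ) :
    η₀ ∈ Iphi μ ν φ := by
  have hself : ν ∈ cxInterval η₀ ν := h ▸ self_mem_I hμ hν
  have hmem : η₀ ∈ I μ ν := h ▸ ⟨hη₀.1, CxLE.refl η₀, hself.2.1⟩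
  refine ⟨hmem, fun η hη => ?_⟩
  have hη' : η ∈ cxInterval η₀ ν := h ▸ hη
  exact hη'.2.1 φ hφ.1.convexOn (integralMakesSense_of_convexOn hη₀ hφ.1.convexOn)
    (integralMakesSense_of_convexOn hη.1 hφ.1.convexOn)

/-- Minimality for all admissible `φ` yields `η₀ ≤_cx η` on `I μ ν`. Conversely, for `η` between
`η₀` and `ν` the maximal correlation with `μ` is at least that of `η₀`, which is already optimal for
`ν`. -/
theorem I_eq_cxInterval {μ ν η₀ : Measure (E d)} (hμ : μ ∈ P2 d) (hν : ν ∈ P2 d)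
    (hη₀ : η₀ ∈ I μ ν) (h : ∀ φ, Admissible ν φ → η₀ ∈ Iphi μ ν φ) :
    I μ ν = cxInterval η₀ ν := by
  refine Subset.antisymm (fun η hη => ⟨hη.1.1, ?_, hη.2.1⟩) fun η hη => ?_
  · refine PosCx.cxLE (posCx_of_strictConvexOn hη.1 hν fun ψ hψ h0 hfin => ?_) hη₀.1 hη.1
    have := (h ψ ⟨hψ, hfin⟩).2 η hη
    rwa [extIntegral_of_nonneg _ h0, extIntegral_of_nonneg _ h0,
      EReal.coe_ennreal_le_coe_ennreal_iff] at this
  · have hη2 := hη.2.2.posCx.mem_P2 hη.1 hν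
    obtain ⟨-, -, π, hπ, hle⟩ := (mem_I_iff hμ hν).1 hη₀
    obtain ⟨ρ, hρ, hπρ⟩ := hη.2.1.posCx.exists_coupling_corr_le hμ hη₀.1 hη2 hπ
    exact (mem_I_iff hμ hν).2
      ⟨hη.1, hη.2.2.posCx, ρ, hρ, fun π' hπ' => (hle π' hπ').trans hπρ⟩

end QuadOT

open QuadOT
theorem corollary1 (d : ℕ) (μ ν : Measure (E d)) (hμ : μ ∈ P2 d) (hν : ν ∈ P2 d) :
    (∀ φ : E d → ℝ, Admissible ν φ → ∃! η, IsEtaPhi μ ν φ η) ∧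
    ∃ ηmin : Measure (E d), Iphi μ ν (fun x => ‖x‖ ^ 2) = {ηmin} ∧
      ((∃ η₀ ∈ P2 d, I μ ν = cxInterval η₀ ν) ↔
        {η | ∃ φ : E d → ℝ, Admissible ν φ ∧ IsEtaPhi μ ν φ η} = {ηmin}) ∧
      ∀ η₀ ∈ P2 d, I μ ν = cxInterval η₀ ν → η₀ = ηmin := by
  have hsing : ∀ φ : E d → ℝ, Admissible ν φ → ∃ η, Iphi μ ν φ = {η} :=
    fun φ hφ => exists_Iphi_eq_singleton hμ hν hφ
  refine ⟨fun φ hφ => ?_, ?_⟩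
  · obtain ⟨η, hη⟩ := hsing φ hφ
    exact ⟨η, (isEtaPhi_iff hη η).2 rfl, fun ξ hξ => (isEtaPhi_iff hη ξ).1 hξ⟩
  obtain ⟨ηmin, hmin⟩ := hsing _ (admissible_norm_sq hν)
  have hunique : ∀ η₀ ∈ P2 d, I μ ν = cxInterval η₀ ν → η₀ = ηmin := fun η₀ hη₀ h =>
    hmin.subset (mem_Iphi_of_I_eq_cxInterval hμ hν hη₀ h (admissible_norm_sq hν))
  refine ⟨ηmin, hmin, ⟨?_, fun h => ?_⟩, hunique⟩
  · rintro ⟨η₀, hη₀, h⟩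
    obtain rfl := hunique η₀ hη₀ h
    refine Set.Subset.antisymm ?_ (Set.singleton_subset_iff.2
      ⟨_, admissible_norm_sq hν, (isEtaPhi_iff hmin η₀).2 rfl⟩)
    rintro η ⟨φ, hφ, hη⟩
    obtain ⟨ξ, hξ⟩ := hsing φ hφ
    have h1 : η₀ = ξ := hξ.subset (mem_Iphi_of_I_eq_cxInterval hμ hν hη₀ h hφ)
    exact ((isEtaPhi_iff hξ η).1 hη).trans h1.symm
  · have hmem : ηmin ∈ I μ ν := (hmin.superset rfl : ηmin ∈ Iphi μ ν _).1
    refine ⟨ηmin, hmem.1, I_eq_cxInterval hμ hν hmem fun φ hφ => ?_⟩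
    obtain ⟨ξ, hξ⟩ := hsing φ hφ
    -- The sole minimizer for `φ` is one of the `η_φ`, so the hypothesis on their set identifies it
    -- with `ηmin`.
    have h1 : ξ = ηmin := h.subset ⟨φ, hφ, (isEtaPhi_iff hξ ξ).2 rfl⟩
    exact hξ ▸ h1.symm
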